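/- Let $d\ge 2$, $p\in(0,1/2)$, and let $\nu$ be a probability distribution on $\{0,1,2,\dots\}$. Put $$p_d^*=\frac{p(d-1)}{d-(d+1)p},\qquad \hat p=\frac{p}{1-p}.$$ The self-similar frog model $\mathrm{SFM}(d,p,\nu)$ on the infinite rooted $d$-ary tree with root $\varnothing$ is the following process in discrete time. Initially one frog is awake at $\varnothing$, and the other vertices carry independent $\nu$-distributed numbers of dormant frogs; only $\varnothing$ counts as visited. At every time step all awake frogs jump simultaneously, the jumps being independent given the past: - The first jump of the initial frog is to a uniformly chosen child of $\varnothing$. - The first jump of a frog that has just been activated is to the parent vertex with probability $p_d^*$, and otherwise to a uniformly chosen child. - A frog whose previous jump was towards the root (to the parent vertex) jumps to the parent again with probability $\hat p$, and otherwise to a uniformly chosen child other than the one that it has just come from. - A frog whose previous jump was away from the root jumps to a uniformly chosen child. When a vertex is visited for the first time, all dormant frogs there become active, and they jump from the next time step on. A frog that jumps to $\varnothing$ is killed there. A frog that jumps away from the root to a vertex that has been visited before is killed. If several frogs jump at the same time to the same unvisited vertex, one of them, chosen according to a fixed priority order on the frogs, continues its path and the others are killed. Let $V_{\mathrm{SFM}(d,p,\nu)}\in\{0,1,2,\dots\}\cup\{\infty\}$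 be the total number of jumps of frogs to $\varnothing$. **Theorem.** For all $p\in(0,1/2)$, all $d\ge2$, every $\nu$, and every choice of the priority orders in the two models, $$V_{\mathrm{SFM}(d,p,\nu)}\preceq V_{\mathrm{SFM}(d+1,p,\nu)},$$ that is, there is a coupling of the laws of the two random variables under which $V_{\mathrm{SFM}(d,p,\nu)}\le V_{\mathrm{SFM}(d+1,p,\nu)}$ almost surely. -/

import Mathlib

open MeasureTheory

namespace SelfSimilarFrog

/-- Vertices of the infinite rooted `d`-ary tree: `[]` is the root and the children of `v` are
`j :: v`, `j : Fin d`; the parent of `j :: v` is `v`. -/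
abbrev Vertex (d : ℕ) := List (Fin d)

/-- One jump of a frog: to the parent vertex, or to the `j`-th child. -/
inductive Move (d : ℕ) where
  | toParent : Move d
  | toChild (j : Fin d) : Move d
  deriving DecidableEq

/-- What the jump distribution of an awake frog depends on: the frog was just activated; or its
previous jump was towards the root, out of the `c`-th child of its present position; or its previous
jump was away from the root. -/
inductive Mode (d : ℕ) where
  | justWoken : Mode d
  | cameUp (c : Fin d) : Mode d
  | movingDown : Mode d
  deriving DecidableEq

/-- Labels of frogs: `none` is the frog that is initially awake at the root, and `some (v, i)` is the
`i`-th frog at `v` (it exists if `i` is less than the number of frogs initially placed at `v`). -/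
abbrev Frog (d : ℕ) := Option (Vertex d × ℕ)

instance (d : ℕ) : MeasurableSpace (Move d) := ⊤

/-- `Move d` as `Option (Fin d)`. -/
def moveEquiv (d : ℕ) : Option (Fin d) ≃ Move d where
  toFun o := match o with
    | none => .toParent
    | some j => .toChild j
  invFun m := match m with
    | .toParent => none
    | .toChild j => some j
  left_inv o := by cases o <;> rfl
  right_inv m := by cases m <;> rfl

instance (d : ℕ) : Fintype (Move d) := Fintype.ofEquiv _ (moveEquiv d)

/-- `p_d^* = p (d - 1) / (d - (d + 1) p)`. -/
noncomputable def pStar (d : ℕ) (p : ℝ) : ℝ := p * (d - 1) / (d - (d + 1) * p)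

/-- `p̂ = p / (1 - p)`. -/
noncomputable def pHat (p : ℝ) : ℝ := p / (1 - p)

/-- The jump probabilities. A just activated frog jumps to the parent with probability `p_d^*` and
otherwise to a uniform child. A frog that has just jumped towards the root does so again with
probability `p̂`, and otherwise jumps to a uniform child other than the one it came from. A frog that
has just jumped away from the root jumps to a uniform child. -/
noncomputable def jumpProb (d : ℕ) (p : ℝ) : Mode d → Move d → ℝ
  | .justWoken, .toParent => pStar d p
  | .justWoken, .toChild _ => (1 - pStar d p) / d
  | .cameUp _, .toParent => pHat p
  | .cameUp c, .toChild j => if j = c then 0 else (1 - pHat p) / (d - 1)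
  | .movingDown, .toParent => 0
  | .movingDown, .toChild _ => 1 / d

theorem jumpProb_nonneg {d : ℕ} {p : ℝ} (hd : 2 ≤ d) (hp : p ∈ Set.Ioo (0 : ℝ) (1 / 2))
    (s : Mode d) (m : Move d) : 0 ≤ jumpProb d p s m := by
  obtain ⟨h0, h1⟩ := hp
  have hd' : (2 : ℝ) ≤ d := by exact_mod_cast hd
  have hden : 0 < (d : ℝ) - (d + 1) * p := by nlinarith
  have hs0 : 0 ≤ pStar d p := div_nonneg (mul_nonneg h0.le (by linarith)) hden.le
  have hs1 : pStar d p ≤ 1 := by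
    rw [pStar, div_le_one hden]; nlinarith
  have hh0 : 0 ≤ pHat p := div_nonneg h0.le (by linarith)
  have hh1 : pHat p ≤ 1 := by
    rw [pHat, div_le_one (by linarith)]; linarith
  cases s <;> cases m <;> simp only [jumpProb] <;> try split_ifs
  all_goals first
    | exact hs0
    | exact hh0
    | exact le_rfl
    | exact div_nonneg (by linarith) (by linarith)

theorem sum_jumpProb {d : ℕ} {p : ℝ} (hd : 2 ≤ d) (s : Mode d) :
    ∑ m, jumpProb d p s m = 1 := by
  have hd' : (2 : ℝ) ≤ d := by exact_mod_cast hd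
  have hd0 : (d : ℝ) ≠ 0 := by linarith
  have hd1 : (d : ℝ) - 1 ≠ 0 := by linarith
  rw [← (moveEquiv d).sum_comp, Fintype.sum_option]
  cases s with
  | justWoken => simp [moveEquiv, jumpProb]; field_simp; ring
  | cameUp c =>
    have h : ∀ j : Fin d, (if j = c then (0 : ℝ) else (1 - pHat p) / (d - 1)) =
        (1 - pHat p) / (d - 1) - if j = c then (1 - pHat p) / (d - 1) else 0 := by
      intro j; split_ifs <;> ring
    simp only [moveEquiv, Equiv.coe_fn_mk, jumpProb, h, Finset.sum_sub_distrib, Finset.sum_const,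
      Finset.card_univ, Fintype.card_fin, nsmul_eq_mul, Finset.sum_ite_eq', Finset.mem_univ,
      if_true]
    field_simp; ring
  | movingDown => simp [moveEquiv, jumpProb]; field_simp

/-- The law of the next jump of a frog in mode `s`. -/
noncomputable def jumpLaw {d : ℕ} {p : ℝ} (hd : 2 ≤ d) (hp : p ∈ Set.Ioo (0 : ℝ) (1 / 2))
    (s : Mode d) : PMF (Move d) :=
  PMF.ofFintype (fun m => ENNReal.ofReal (jumpProb d p s m)) (by
    rw [← ENNReal.ofReal_sum_of_nonneg (fun m _ => jumpProb_nonneg hd hp s m), sum_jumpProb hd s,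
      ENNReal.ofReal_one])

/-- The randomness: the number of frogs placed at each vertex (the number at the root plays no role),
and for each time `t`, frog `f` and mode `s`, the jump that `f` makes at time `t` if it is then awake
and in mode `s`. -/
abbrev Sample (d : ℕ) := (Vertex d → ℕ) × (ℕ × Frog d × Mode d → Move d)

/-- All the random inputs are independent, the numbers of frogs have law `ν`, and the jumps have the
laws prescribed by the modes. -/
noncomputable def sampleLaw {d : ℕ} {p : ℝ} (hd : 2 ≤ d) (hp : p ∈ Set.Ioo (0 : ℝ) (1 / 2))
    (ν : PMF ℕ) : Measure (Sample d) :=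
  (Measure.infinitePi fun _ : Vertex d => ν.toMeasure).prod
    (Measure.infinitePi fun i : ℕ × Frog d × Mode d => (jumpLaw hd hp i.2.2).toMeasure)

/-- A configuration: the set of visited vertices, and for each frog its position and mode if it is
awake, and `none` if it is dormant or has been killed. (A frog at a nonroot vertex is dormant exactly
as long as that vertex is unvisited.) -/
structure Config (d : ℕ) where
  visited : Set (Vertex d)
  awake : Frog d → Option (Vertex d × Mode d)

/-- Initially only the root is visited, and one frog is awake there. It moves to a uniform child in
its first jump, which is what `movingDown` prescribes. -/
def Config.init (d : ℕ) : Config d where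
  visited := {[]}
  awake
    | none => some ([], .movingDown)
    | some _ => none

section Step

variable {d : ℕ} (rank : Frog d → ℕ) (count : Vertex d → ℕ) (jump : Frog d → Mode d → Move d)
  (S : Config d)

/-- Frog `f` is awake at `v` and jumps to the parent of `v`. -/
def JumpsUp (f : Frog d) (v : Vertex d) : Prop :=
  ∃ s, S.awake f = some (v, s) ∧ jump f s = .toParent

/-- Frog `f` is awake and jumps away from the root, to the vertex `w`. -/
def JumpsDownTo (f : Frog d) (w : Vertex d) : Prop :=
  ∃ v s j, S.awake f = some (v, s) ∧ jump f s = .toChild j ∧ w = j :: v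

/-- Frog `f` jumps away from the root to the vertex `w` and survives: `w` was not visited before, and
among the frogs that now jump to `w`, frog `f` is the chosen one (the one of the lowest rank). -/
def SurvivesAt (f : Frog d) (w : Vertex d) : Prop :=
  JumpsDownTo jump S f w ∧ w ∉ S.visited ∧ ∀ g, JumpsDownTo jump S g w → rank f ≤ rank g

open Classical in
/-- Position and mode of frog `f` after all awake frogs have jumped simultaneously. A frog that jumps
to the root is killed, and so is a frog that jumps away from the root and does not survive. A frog
placed at `w` wakes up when `w` is visited for the first time. -/
noncomputable def nextAwake (f : Frog d) : Option (Vertex d × Mode d) :=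
  match S.awake f with
  | some (v, s) =>
    match jump f s, v with
    | .toParent, c :: b :: u => some (b :: u, .cameUp c)
    | .toParent, _ => none
    | .toChild j, v => if SurvivesAt rank jump S f (j :: v) then some (j :: v, .movingDown) else none
  | none =>
    match f with
    | none => none
    | some (w, i) =>
      if w ∉ S.visited ∧ (∃ g, JumpsDownTo jump S g w) ∧ i < count w then some (w, .justWoken)
      else none

/-- The configuration after all awake frogs have jumped simultaneously. -/
noncomputable def Config.next : Config d where
  visited := S.visited ∪ {w | ∃ f, JumpsDownTo jump S f w}
  awake := nextAwake rank count jump S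

end Step

/-- The configuration at time `t`. -/
noncomputable def config {d : ℕ} (rank : Frog d → ℕ) (ω : Sample d) : ℕ → Config d
  | 0 => Config.init d
  | t + 1 => (config rank ω t).next rank ω.1 (fun f s => ω.2 (t, f, s))

/-- The total number of root visits: the number of pairs of a time `t` and a frog that jumps from a
child of the root to the root at time `t`. -/
noncomputable def rootVisits {d : ℕ} (rank : Frog d → ℕ) (ω : Sample d) : ℕ∞ :=
  Set.encard {x : ℕ × Frog d |
    ∃ j : Fin d, JumpsUp (fun f s => ω.2 (x.1, f, s)) (config rank ω x.1) x.2 [j]}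

/-- `X ⪯ Y`: there is a coupling of the laws of `X` and `Y` under which `X ≤ Y` almost surely. -/
def StochLE {Ω Ω' : Type*} [MeasurableSpace Ω] [MeasurableSpace Ω'] (P : Measure Ω)
    (P' : Measure Ω') (X : Ω → ℕ∞) (Y : Ω' → ℕ∞) : Prop :=
  ∃ γ : Measure (ℕ∞ × ℕ∞), IsProbabilityMeasure γ ∧ γ.map Prod.fst = P.map X ∧
    γ.map Prod.snd = P'.map Y ∧ ∀ᵐ z ∂γ, z.1 ≤ z.2

end SelfSimilarFrog

/-! By the quantile coupling (`stochLE_of_tail_le`) it suffices to show that each tail probability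
of the number of root visits for `d` is at most the one for `d + 1`. The proof computes these tails
by a recursion on depth and compares the recursions.

Abelian property. Attach the jumps to vertices instead of frogs: the `i`-th frog that leaves `v` in
mode `s` uses the instruction `η (v, s, i)`. Every jump then still reads a fresh instruction of the
right law, so the number of root visits keeps its law (`frogExits_law`). The priority order drops
out, since exactly one of the frogs that reach a new vertex survives. For fixed stacks, the
instructions executed by time `T` form an increasing family, whose limit is described by least
closed sets and does not depend on the timing. Hence the dynamics at a vertex can be rearranged: a
child that is visited for the first time sends back all its frogs at once, and pending instructions
are executed one by one (`explore`, `localExits_spec`). Cutting the tree `n` levels below a vertex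
gives `subtreeExits n`; the root visits reach `m` exactly when `subtreeExits n` does for some `n`,
at the child entered by the initial frog (`exists_le_exits_iff`). Subtrees of distinct children are
independent and alike, so the law `exitLaw n` satisfies a recursion in `n`.

Local chain. When `g` children are unvisited, a pending frog leaves upwards with probability `up`,
opens a new child with probability `g * σ`, and otherwise dies. This is the recursion `chain`.
Additional pending frogs and additional opened children can only help (`chain_le_insert`,
`chain_le_chainNext`).

Comparison. The first frog at a vertex opens one child, which leaves `d - 1` unvisited children in
degree `d` and `d` in degree `d + 1`. Compare `g` unvisited children in degree `d` with `g + 1` in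
degree `d + 1`. The probability of leaving does not decrease, because `pStar` increases with the
degree and `pHat` is free of it. Nor does the probability of opening a child: for returned frogs
this is `g / (d - 1) ≤ (g + 1) / d`, and a similar inequality holds for woken frogs (`upProb_mono`,
`childProb_mono`). All mass taken from dying goes to better outcomes, so `chain_le_chain` applies,
and induction on the depth yields `exitLaw_tail_le`. -/

namespace SelfSimilarFrog

/-! ### Resampling and conditioning in product measures -/

section Product

variable {ι : Type*} {X : ι → Type*} [∀ i, MeasurableSpace (X i)]
  (μ : ∀ i, Measure (X i)) [∀ i, IsProbabilityMeasure (μ i)]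

open Classical in
/-- Replacing the coordinates outside `s` of a sample from a product measure by those of an
independent sample does not change the law. -/
theorem measurePreserving_piecewise (s : Set ι) :
    MeasurePreserving (fun z : (∀ i, X i) × (∀ i, X i) => s.piecewise z.1 z.2)
      ((Measure.infinitePi μ).prod (Measure.infinitePi μ)) (Measure.infinitePi μ) := by
  have hm : Measurable (fun z : (∀ i, X i) × (∀ i, X i) => s.piecewise z.1 z.2) := by
    refine measurable_pi_lambda _ fun i => ?_
    by_cases hi : i ∈ s
    · simp only [Set.piecewise, hi, if_true]; fun_prop
    · simp only [Set.piecewise, hi, if_false]; fun_prop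
  refine ⟨hm, Measure.eq_infinitePi (μ := μ) fun t B hB => ?_⟩
  rw [Measure.map_apply hm (MeasurableSet.pi t.countable_toSet fun i _ => hB i)]
  have : (fun z : (∀ i, X i) × (∀ i, X i) => s.piecewise z.1 z.2) ⁻¹' (t : Set ι).pi B =
      ((t.filter (· ∈ s) : Finset ι) : Set ι).pi B ×ˢ
        ((t.filter (· ∉ s) : Finset ι) : Set ι).pi B := by
    ext z
    simp only [Set.mem_preimage, Set.mem_pi, Finset.coe_filter, Set.mem_prod, Set.mem_ofPred_eq,
      Finset.mem_coe]
    constructor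
    · intro h
      exact ⟨fun i hi => by simpa [hi.2] using h i hi.1, fun i hi => by simpa [hi.2] using h i hi.1⟩
    · rintro ⟨h1, h2⟩ i hi
      by_cases his : i ∈ s
      · simpa [his] using h1 i ⟨hi, his⟩
      · simpa [his] using h2 i ⟨hi, his⟩
  rw [this, Measure.prod_prod, Measure.infinitePi_pi _ (fun i _ => hB i),
    Measure.infinitePi_pi _ (fun i _ => hB i), Finset.prod_filter_mul_prod_filter_not]

/-- Events that depend on disjoint sets of coordinates are independent. -/
theorem infinitePi_inter_of_dependsOn (s : Set ι) {C G : Set (∀ i, X i)} (hC : MeasurableSet C)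
    (hG : MeasurableSet G) (hCs : ∀ x y : ∀ i, X i, (∀ i ∈ s, x i = y i) → x ∈ C → y ∈ C)
    (hGs : ∀ x y : ∀ i, X i, (∀ i ∉ s, x i = y i) → x ∈ G → y ∈ G) :
    Measure.infinitePi μ (C ∩ G) = Measure.infinitePi μ C * Measure.infinitePi μ G := by
  classical
  rw [← (measurePreserving_piecewise μ s).measure_preimage (hC.inter hG).nullMeasurableSet,
    ← Measure.prod_prod]
  congr 1
  ext z
  simp only [Set.mem_preimage, Set.mem_inter_iff, Set.mem_prod]
  refine and_congr ⟨hCs _ _ fun i hi => by simp [hi], hCs _ _ fun i hi => by simp [hi]⟩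
    ⟨hGs _ _ fun i hi => by simp [hi], hGs _ _ fun i hi => by simp [hi]⟩

/-- Conditioning on a single coordinate of a product measure. -/
theorem lintegral_infinitePi_coordinate (i : ι) (f : X i → (∀ j, X j) → ENNReal)
    (hf : Measurable (Function.uncurry f))
    (hfi : ∀ x (y z : ∀ j, X j), (∀ j, j ≠ i → y j = z j) → f x y = f x z) :
    ∫⁻ ω, f (ω i) ω ∂Measure.infinitePi μ = ∫⁻ x, ∫⁻ ω, f x ω ∂Measure.infinitePi μ ∂μ i := by
  classical
  have h1 : Measurable fun ω : ∀ j, X j => f (ω i) ω :=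
    hf.comp ((measurable_pi_apply i).prodMk measurable_id)
  rw [← (measurePreserving_piecewise μ {i}).lintegral_comp h1]
  refine (lintegral_congr (g := fun z => f (z.1 i) z.2) fun z => ?_).trans ?_
  · refine (hfi _ _ z.2 fun j hj => ?_).trans (congrArg (fun x => f x z.2) ?_)
    · exact Set.piecewise_eq_of_notMem _ _ _ hj
    · exact Set.piecewise_eq_of_mem _ _ _ rfl
  rw [lintegral_prod _ (by fun_prop (disch := assumption))]
  have h3 : Measurable fun x => ∫⁻ ω, f x ω ∂Measure.infinitePi μ := hf.lintegral_prod_right'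
  rw [← Measure.infinitePi_map_eval μ i, lintegral_map h3 (measurable_pi_apply i)]

end Product

/-- Conditioning on finitely many coordinates of a product of discrete measures. -/
theorem infinitePi_eq_sum_of_finite {ι A M : Type*} [Fintype A] [DecidableEq A] [Fintype M] [MeasurableSpace M]
    [MeasurableSingletonClass M] (μ : ι → Measure M) [∀ i, IsProbabilityMeasure (μ i)]
    (κ : A → ι) (hκ : Function.Injective κ) (E : Set (ι → M)) (G : (A → M) → Set (ι → M))
    (hG : ∀ x, MeasurableSet (G x))
    (hE : ∀ x ω, (∀ a, ω (κ a) = x a) → (ω ∈ E ↔ ω ∈ G x))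
    (hGκ : ∀ x (y z : ι → M), (∀ i ∉ Set.range κ, y i = z i) → y ∈ G x → z ∈ G x) :
    MeasurableSet E ∧ Measure.infinitePi μ E =
      ∑ x : A → M, (∏ a, μ (κ a) {x a}) * Measure.infinitePi μ (G x) := by
  classical
  set C : (A → M) → Set (ι → M) := fun x => {ω | ∀ a, ω (κ a) = x a}
  have hC : ∀ x, MeasurableSet (C x) := fun x => by
    have : C x = ⋂ a, (fun ω : ι → M => ω (κ a)) ⁻¹' {x a} := by ext; simp [C]
    rw [this]
    exact MeasurableSet.iInter fun a => measurable_pi_apply _ (measurableSet_singleton _)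
  have hEC : E = ⋃ x ∈ (Finset.univ : Finset (A → M)), C x ∩ G x := by
    ext ω
    simp only [Finset.mem_univ, Set.iUnion_true, Set.mem_iUnion, Set.mem_inter_iff]
    constructor
    · exact fun h => ⟨fun a => ω (κ a), fun a => rfl, (hE _ ω fun a => rfl).1 h⟩
    · rintro ⟨x, hx, hx'⟩
      exact (hE x ω hx).2 hx'
  refine ⟨?_, ?_⟩
  · rw [hEC]
    exact Finset.measurableSet_biUnion _ fun x _ => (hC x).inter (hG x)
  rw [hEC, measure_biUnion_finset _ fun x _ => (hC x).inter (hG x)]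
  · refine Finset.sum_congr rfl fun x _ => ?_
    rw [infinitePi_inter_of_dependsOn μ (Set.range κ) (hC x) (hG x) _ (hGκ x)]
    · congr 1
      have : C x = ((Finset.univ.image κ : Finset ι) : Set ι).pi
          fun i => {m | ∀ a, κ a = i → m = x a} := by
        ext ω
        simp only [C, Set.mem_ofPred_eq, Finset.coe_image, Finset.coe_univ, Set.image_univ,
          Set.mem_pi, Set.forall_mem_range]
        exact ⟨fun h a b hb => (hκ hb) ▸ h a, fun h a => h a a rfl⟩
      rw [this, Measure.infinitePi_pi, Finset.prod_image hκ.injOn]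
      · refine Finset.prod_congr rfl fun a _ => ?_
        congr 1
        ext m
        simp only [Set.mem_ofPred_eq, Set.mem_singleton_iff]
        exact ⟨fun h => h a rfl, fun h b hb => hκ hb ▸ h⟩
      · exact fun i _ => Set.Finite.measurableSet (Set.toFinite _)
    · intro y z hyz hy a
      rw [← hyz _ ⟨a, rfl⟩]
      exact hy a
  · intro x _ y _ hxy
    refine Set.disjoint_left.2 fun ω h1 h2 => hxy ?_
    funext a
    rw [← h1.1 a, h2.1 a]

/-! ### Laws on `ℕ∞`: tails, quantiles and the monotone coupling -/

theorem ext_of_tails {α β : Measure ℕ∞} [IsProbabilityMeasure α] [IsProbabilityMeasure β]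
    (h : ∀ m : ℕ, α {z | m ≤ z} = β {z | m ≤ z}) : α = β := by
  refine ext_of_generate_finite (Set.range fun m : ℕ => {z : ℕ∞ | m ≤ z}) ?_ ?_ ?_ (by simp)
  -- A finite point is a difference of consecutive tails, `⊤` is the intersection of all tails, and
  -- `ℕ∞` is countable; so the tails generate every set.
  · refine le_antisymm ?_ (MeasurableSpace.generateFrom_le fun s _ => trivial)
    set C := Set.range fun m : ℕ => {z : ℕ∞ | m ≤ z}
    have hC : ∀ m : ℕ, MeasurableSet[MeasurableSpace.generateFrom C] {z : ℕ∞ | m ≤ z} :=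
      fun m => MeasurableSpace.measurableSet_generateFrom ⟨m, rfl⟩
    have hs : ∀ z : ℕ∞, MeasurableSet[MeasurableSpace.generateFrom C] {z} := by
      intro z
      induction z using ENat.recTopCoe with
      | top =>
        have : ({⊤} : Set ℕ∞) = ⋂ m : ℕ, {z : ℕ∞ | m ≤ z} := by
          ext z
          simp only [Set.mem_singleton_iff, Set.mem_iInter, Set.mem_ofPred_eq]
          exact ⟨fun h => by simp [h], fun h => ENat.eq_top_iff_forall_ge.2 h⟩
        rw [this]
        exact MeasurableSet.iInter hC
      | coe m =>
        have : ({(m : ℕ∞)} : Set ℕ∞) = {z : ℕ∞ | m ≤ z} \ {z : ℕ∞ | (m + 1 : ℕ) ≤ z} := by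
          ext z
          induction z using ENat.recTopCoe with
          | top => simp
          | coe n =>
            simp only [Set.mem_singleton_iff, Set.mem_sdiff, Set.mem_ofPred_eq, Nat.cast_le,
              Nat.cast_inj]
            omega
        rw [this]
        exact (hC m).diff (hC (m + 1))
    intro s _
    rw [← Set.biUnion_of_singleton s]
    exact MeasurableSet.biUnion s.to_countable fun z _ => hs z
  · rintro _ ⟨m, rfl⟩ _ ⟨n, rfl⟩ _
    refine ⟨max m n, ?_⟩
    ext z
    rcases le_total m n with hmn | hmn
    · have : (m : ℕ∞) ≤ n := Nat.cast_le.2 hmn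
      simp only [max_eq_right hmn, Set.mem_ofPred_eq, Set.mem_inter_iff]
      exact ⟨fun h => ⟨this.trans h, h⟩, fun h => h.2⟩
    · have : (n : ℕ∞) ≤ m := Nat.cast_le.2 hmn
      simp only [max_eq_left hmn, Set.mem_ofPred_eq, Set.mem_inter_iff]
      exact ⟨fun h => ⟨h, this.trans h⟩, fun h => h.1⟩
  · rintro _ ⟨m, rfl⟩
    exact h m

theorem measurable_of_tails {α : Type*} [MeasurableSpace α] {f : α → ℕ∞}
    (h : ∀ m : ℕ, MeasurableSet {a | m ≤ f a}) : Measurable f := by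
  refine measurable_to_countable' fun z => ?_
  induction z using ENat.recTopCoe with
  | top =>
    have : f ⁻¹' {⊤} = ⋂ m : ℕ, {a | m ≤ f a} := by
      ext a
      simp only [Set.mem_singleton_iff, Set.mem_iInter, Set.mem_ofPred_eq, Set.mem_preimage]
      exact ⟨fun h => by simp [h], fun h => ENat.eq_top_iff_forall_ge.2 h⟩
    rw [this]
    exact MeasurableSet.iInter h
  | coe m =>
    have : f ⁻¹' {(m : ℕ∞)} = {a | m ≤ f a} \ {a | (m + 1 : ℕ) ≤ f a} := by
      ext a
      simp only [Set.mem_preimage, Set.mem_singleton_iff, Set.mem_sdiff, Set.mem_ofPred_eq]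
      induction f a using ENat.recTopCoe with
      | top => simp
      | coe n => simp only [Nat.cast_le, Nat.cast_inj]; omega
    rw [this]
    exact (h m).diff (h _)

/-- The quantile function of a law on `ℕ∞`, in terms of its tails. -/
noncomputable def quantile (T : ℕ → ENNReal) (u : ℝ) : ℕ∞ :=
  ⨆ n : ℕ, if ENNReal.ofReal u < T n then (n : ℕ∞) else 0

/-- The value 0 of the `else` branch makes the left side always true for `m = 0`, whatever `T 0` is;
hence `m ≠ 0`. -/
theorem le_quantile_iff {T : ℕ → ENNReal} (hT : Antitone T) {u : ℝ} (m : ℕ) (hm : m ≠ 0) :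
    (m : ℕ∞) ≤ quantile T u ↔ ENNReal.ofReal u < T m := by
  constructor
  · intro h
    by_contra hlt
    have : quantile T u ≤ (m - 1 : ℕ) := by
      refine iSup_le fun n => ?_
      split_ifs with hn
      · have : n < m := by
          by_contra hmn
          exact hlt (hn.trans_le (hT (not_lt.1 hmn)))
        exact_mod_cast (by omega : n ≤ m - 1)
      · exact zero_le
    have := h.trans this
    rw [Nat.cast_le] at this
    omega
  · intro h
    refine le_trans ?_ (le_iSup _ m)
    rw [if_pos h]

theorem measurable_quantile (T : ℕ → ENNReal) (hT : Antitone T) : Measurable (quantile T) := by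
  refine measurable_of_tails fun m => ?_
  rcases eq_or_ne m 0 with rfl | h0
  · simp
  · simp only [le_quantile_iff hT m h0]
    exact measurableSet_lt (by fun_prop) measurable_const

/-- For `u` uniform on `[0, 1)`, the event `u < T m` has probability `T m`, so the quantile function
has the prescribed tails. -/
theorem map_quantile (α : Measure ℕ∞) [IsProbabilityMeasure α] :
    (volume.restrict (Set.Ico (0 : ℝ) 1)).map (quantile fun n => α {z | n ≤ z}) = α := by
  have hT : Antitone fun n : ℕ => α {z : ℕ∞ | n ≤ z} := fun m n hmn =>
    measure_mono fun z hz => (Nat.cast_le.2 hmn : (m : ℕ∞) ≤ n).trans hz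
  have hq := measurable_quantile _ hT
  have : IsProbabilityMeasure (volume.restrict (Set.Ico (0 : ℝ) 1)) := ⟨by simp⟩
  have := Measure.isProbabilityMeasure_map (μ := volume.restrict (Set.Ico (0 : ℝ) 1))
    hq.aemeasurable
  refine ext_of_tails fun m => ?_
  rcases eq_or_ne m 0 with rfl | h0
  · simp
  rw [Measure.map_apply hq trivial]
  have h1 : (quantile fun n => α {z | n ≤ z}) ⁻¹' {z : ℕ∞ | m ≤ z} =
      {u | ENNReal.ofReal u < α {z | (m : ℕ∞) ≤ z}} := by
    ext u
    exact le_quantile_iff hT m h0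
  rw [h1, Measure.restrict_apply (measurableSet_lt (by fun_prop) measurable_const)]
  have h2 : {u | ENNReal.ofReal u < α {z | (m : ℕ∞) ≤ z}} ∩ Set.Ico (0 : ℝ) 1 =
      Set.Ico 0 (α {z | (m : ℕ∞) ≤ z}).toReal := by
    have hle : (α {z | (m : ℕ∞) ≤ z}).toReal ≤ 1 := by
      have := ENNReal.toReal_mono ENNReal.one_ne_top (prob_le_one (μ := α) (s := {z | (m : ℕ∞) ≤ z}))
      simpa using this
    ext u
    simp only [Set.mem_inter_iff, Set.mem_ofPred_eq, Set.mem_Ico]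
    constructor
    · rintro ⟨h, h0, _⟩
      exact ⟨h0, (ENNReal.ofReal_lt_iff_lt_toReal h0 (measure_ne_top _ _)).1 h⟩
    · rintro ⟨h0, h⟩
      exact ⟨(ENNReal.ofReal_lt_iff_lt_toReal h0 (measure_ne_top _ _)).2 h, h0, h.trans_le hle⟩
  rw [h2, Real.volume_Ico, sub_zero, ENNReal.ofReal_toReal (measure_ne_top _ _)]

/-- The quantile coupling: `X ⪯ Y` if the tails of `X` are bounded by those of `Y`. -/
theorem stochLE_of_tail_le {Ω Ω' : Type*} [MeasurableSpace Ω] [MeasurableSpace Ω']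
    {P : Measure Ω} {P' : Measure Ω'} [IsProbabilityMeasure P] [IsProbabilityMeasure P']
    {X : Ω → ℕ∞} {Y : Ω' → ℕ∞} (hX : Measurable X) (hY : Measurable Y)
    (h : ∀ m : ℕ, P {ω | m ≤ X ω} ≤ P' {ω | m ≤ Y ω}) : StochLE P P' X Y := by
  have := Measure.isProbabilityMeasure_map (μ := P) hX.aemeasurable
  have := Measure.isProbabilityMeasure_map (μ := P') hY.aemeasurable
  set U := volume.restrict (Set.Ico (0 : ℝ) 1)
  have : IsProbabilityMeasure U := ⟨by simp [U]⟩
  have hT : ∀ (α : Measure ℕ∞), Antitone fun n : ℕ => α {z : ℕ∞ | n ≤ z} := fun α m n hmn =>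
    measure_mono fun z hz => (Nat.cast_le.2 hmn : (m : ℕ∞) ≤ n).trans hz
  set q := quantile fun n => P.map X {z | n ≤ z}
  set q' := quantile fun n => P'.map Y {z | n ≤ z}
  have hq : Measurable q := measurable_quantile _ (hT _)
  have hq' : Measurable q' := measurable_quantile _ (hT _)
  refine ⟨U.map fun u => (q u, q' u),
    Measure.isProbabilityMeasure_map (hq.prodMk hq').aemeasurable, ?_, ?_, ?_⟩
  · rw [Measure.map_map measurable_fst (hq.prodMk hq')]
    exact map_quantile _
  · rw [Measure.map_map measurable_snd (hq.prodMk hq')]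
    exact map_quantile _
  · rw [ae_map_iff (hq.prodMk hq').aemeasurable
      (Set.to_countable _).measurableSet]
    refine Filter.Eventually.of_forall fun u => iSup_mono fun n => ?_
    have hn : P.map X {z | (n : ℕ∞) ≤ z} ≤ P'.map Y {z | (n : ℕ∞) ≤ z} := by
      rw [Measure.map_apply hX trivial, Measure.map_apply hY trivial]
      exact h n
    split_ifs with h1 h2 h2
    · exact le_rfl
    · exact absurd (h1.trans_le hn) h2
    · exact zero_le
    · exact le_rfl

/-! ### The stack representation -/

/-- `Mode d` as `Option (Option (Fin d))`. -/
def modeEquiv (d : ℕ) : Option (Option (Fin d)) ≃ Mode d where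
  toFun o := match o with
    | none => .justWoken
    | some none => .movingDown
    | some (some c) => .cameUp c
  invFun s := match s with
    | .justWoken => none
    | .movingDown => some none
    | .cameUp c => some (some c)
  left_inv o := by rcases o with _ | _ | _ <;> rfl
  right_inv s := by cases s <;> rfl

instance (d : ℕ) : Fintype (Mode d) := Fintype.ofEquiv _ (modeEquiv d)

instance (d : ℕ) : DiscreteMeasurableSpace (Move d) := ⟨fun _ => trivial⟩

/-- Stacks of instructions: `η (v, s, j)` is the jump made by the `j`-th frog that leaves the vertex
`v` in mode `s`, whichever frog this is. -/
abbrev Stack (d : ℕ) := Vertex d × Mode d × ℕ → Move d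

/-- For each vertex and mode, the number of instructions that have been used, and the number of those
that are used in the next step. -/
structure TokenState (d : ℕ) where
  used : Vertex d → Mode d → ℕ
  pending : Vertex d → Mode d → ℕ
  visited : Set (Vertex d)

namespace TokenState

variable {d : ℕ} (N : Vertex d → ℕ) (η : Stack d) (u : TokenState d)

/-- The number of pending instructions at `v` that point to the parent. -/
def upMoves (v : Vertex d) : ℕ :=
  ∑ s, ((Finset.range (u.pending v s)).filter
    fun i => η (v, s, u.used v s + i) = .toParent).card

/-- Some pending instruction points down to `w`. -/
def Reaches (w : Vertex d) : Prop :=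
  ∃ v s i j, i < u.pending v s ∧ η (v, s, u.used v s + i) = .toChild j ∧ w = j :: v

open Classical in
/-- All pending instructions are executed. -/
noncomputable def next : TokenState d where
  used v s := u.used v s + u.pending v s
  pending v s := match s, v with
    | .cameUp c, b :: w => upMoves η u (c :: b :: w)
    | .cameUp _, [] => 0
    | .justWoken, w => if w ∉ u.visited ∧ Reaches η u w then N w else 0
    | .movingDown, w => if w ∉ u.visited ∧ Reaches η u w then 1 else 0
  visited := u.visited ∪ {w | Reaches η u w}

/-- The number of jumps to the root in the next `k` steps. -/
noncomputable def exits : TokenState d → ℕ → ℕ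
  | _, 0 => 0
  | u, k + 1 => ∑ j : Fin d, upMoves η u [j] + exits (next N η u) k

variable {N η u} {η' : Stack d}

theorem upMoves_congr
    (h : ∀ v s i, i < u.pending v s → η (v, s, u.used v s + i) = η' (v, s, u.used v s + i))
    (v : Vertex d) : upMoves η u v = upMoves η' u v :=
  Finset.sum_congr rfl fun s _ => congrArg Finset.card <| Finset.filter_congr fun i hi => by
    rw [h v s i (Finset.mem_range.1 hi)]

theorem reaches_congr
    (h : ∀ v s i, i < u.pending v s → η (v, s, u.used v s + i) = η' (v, s, u.used v s + i))
    (w : Vertex d) : Reaches η u w ↔ Reaches η' u w := by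
  constructor
  · rintro ⟨v, s, i, j, hi, hj, hw⟩
    exact ⟨v, s, i, j, hi, (h v s i hi).symm.trans hj, hw⟩
  · rintro ⟨v, s, i, j, hi, hj, hw⟩
    exact ⟨v, s, i, j, hi, (h v s i hi).trans hj, hw⟩

theorem next_congr
    (h : ∀ v s i, i < u.pending v s → η (v, s, u.used v s + i) = η' (v, s, u.used v s + i)) :
    next N η u = next N η' u := by
  have hr : Reaches η u = Reaches η' u := funext fun w => propext (reaches_congr h w)
  have hu : upMoves η u = upMoves η' u := funext fun v => upMoves_congr h v
  unfold next
  rw [hr, hu]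

/-- The future reads only unused instructions. This is what makes it independent of the instructions
read in the current step. -/
theorem exits_congr (k : ℕ) : ∀ u : TokenState d,
    (∀ v s j, u.used v s ≤ j → η (v, s, j) = η' (v, s, j)) → exits N η u k = exits N η' u k := by
  induction k with
  | zero => exact fun _ _ => rfl
  | succ k ih =>
    intro u h
    have h1 : ∀ v s i, i < u.pending v s →
        η (v, s, u.used v s + i) = η' (v, s, u.used v s + i) :=
      fun v s i _ => h v s _ (Nat.le_add_right _ _)
    rw [exits, exits, ih _ fun v s j hj => h v s j ((Nat.le_add_right _ _).trans hj),
      next_congr h1]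
    simp only [upMoves_congr h1]

end TokenState

/-! ### One step of the frog model against one step of the stacks -/

section Transfer

variable {d : ℕ} {rank : Frog d → ℕ} {N : Vertex d → ℕ} {jump jump' : Frog d → Mode d → Move d}
  {S : Config d} {u : TokenState d} {η : Stack d}

theorem jumpsUp_congr (h : ∀ f v s, S.awake f = some (v, s) → jump f s = jump' f s) :
    JumpsUp jump S = JumpsUp jump' S := by
  funext f v
  exact propext ⟨fun ⟨s, h1, h2⟩ => ⟨s, h1, (h f v s h1).symm.trans h2⟩,
    fun ⟨s, h1, h2⟩ => ⟨s, h1, (h f v s h1).trans h2⟩⟩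

theorem jumpsDownTo_congr (h : ∀ f v s, S.awake f = some (v, s) → jump f s = jump' f s) :
    JumpsDownTo jump S = JumpsDownTo jump' S := by
  funext f w
  exact propext ⟨fun ⟨v, s, j, h1, h2, h3⟩ => ⟨v, s, j, h1, (h f v s h1).symm.trans h2, h3⟩,
    fun ⟨v, s, j, h1, h2, h3⟩ => ⟨v, s, j, h1, (h f v s h1).trans h2, h3⟩⟩

theorem survivesAt_congr (h : ∀ f v s, S.awake f = some (v, s) → jump f s = jump' f s) :
    SurvivesAt rank jump S = SurvivesAt rank jump' S := by
  funext f w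
  simp only [SurvivesAt, jumpsDownTo_congr h]

theorem config_next_congr (h : ∀ f v s, S.awake f = some (v, s) → jump f s = jump' f s) :
    S.next rank N jump = S.next rank N jump' := by
  have h1 : nextAwake rank N jump S = nextAwake rank N jump' S := by
    funext f
    unfold nextAwake
    rw [survivesAt_congr h, jumpsDownTo_congr h]
    cases hf : S.awake f with
    | none => rfl
    | some vs =>
      obtain ⟨v, s⟩ := vs
      simp only [h f v s hf]
  simp only [Config.next, jumpsDownTo_congr h, h1]

/-- The condition `x ≠ []` records the killing at the root. Together with its two analogues for the
other modes, this turns the step function into events that can be counted (for `Matches`) and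
measured (for `MeasurableConfig`). -/
theorem nextAwake_eq_cameUp_iff {f : Frog d} {x : Vertex d} {c : Fin d} :
    nextAwake rank N jump S f = some (x, .cameUp c) ↔
      x ≠ [] ∧ JumpsUp jump S f (c :: x) := by
  unfold nextAwake JumpsUp
  cases hf : S.awake f with
  | none =>
    rcases f with _ | ⟨w, i⟩
    · simp
    · simp only [reduceCtorEq, false_and, exists_false, and_false, iff_false]
      split_ifs <;> simp
  | some vs =>
    obtain ⟨v, s⟩ := vs
    dsimp only
    cases hj : jump f s with
    | toParent =>
      rcases v with _ | ⟨c', _ | ⟨b, w⟩⟩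
      · simp
      · simp only [reduceCtorEq, false_iff, not_and, not_exists]
        rintro hx s' h
        simp only [Option.some.injEq, Prod.mk.injEq, List.cons.injEq] at h
        exact absurd h.1.2.symm hx
      · simp only [Option.some.injEq, Prod.mk.injEq, Mode.cameUp.injEq, List.cons.injEq]
        constructor
        · rintro ⟨rfl, rfl⟩
          exact ⟨by simp, s, ⟨⟨rfl, rfl⟩, rfl⟩, hj⟩
        · rintro ⟨_, s', ⟨⟨rfl, rfl⟩, rfl⟩, _⟩
          exact ⟨rfl, rfl⟩
    | toChild j =>
      constructor
      · intro h
        dsimp only at h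
        split_ifs at h
        simp at h
      · rintro ⟨_, s', h, h'⟩
        simp only [Option.some.injEq, Prod.mk.injEq] at h
        rw [← h.2, hj] at h'
        simp at h'

theorem nextAwake_eq_movingDown_iff {f : Frog d} {w : Vertex d} :
    nextAwake rank N jump S f = some (w, .movingDown) ↔ SurvivesAt rank jump S f w := by
  unfold nextAwake
  cases hf : S.awake f with
  | none =>
    have : ¬ SurvivesAt rank jump S f w := by
      rintro ⟨⟨v, s, j, h, _⟩, _⟩
      simp [hf] at h
    rcases f with _ | ⟨w', i⟩
    · simp [this]
    · simp only [this, iff_false]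
      split_ifs <;> simp
  | some vs =>
    obtain ⟨v, s⟩ := vs
    dsimp only
    cases hj : jump f s with
    | toParent =>
      have : ¬ SurvivesAt rank jump S f w := by
        rintro ⟨⟨v', s', j, h, h', _⟩, _⟩
        simp only [hf, Option.some.injEq, Prod.mk.injEq] at h
        rw [← h.2, hj] at h'
        simp at h'
      rcases v with _ | ⟨c', _ | ⟨b, w⟩⟩ <;> simp [this]
    | toChild j =>
      have : SurvivesAt rank jump S f w → w = j :: v := by
        rintro ⟨⟨v', s', j', h, h', h''⟩, _⟩
        simp only [hf, Option.some.injEq, Prod.mk.injEq] at h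
        rw [← h.2, hj] at h'
        simp only [Move.toChild.injEq] at h'
        rw [h'', h.1, h']
      constructor
      · intro h
        dsimp only at h
        split_ifs at h with hs
        simp only [Option.some.injEq, Prod.mk.injEq, and_true] at h
        rwa [← h]
      · intro h
        have hw := this h
        subst hw
        dsimp only
        rw [if_pos h]

theorem nextAwake_eq_justWoken_iff {f : Frog d} {w : Vertex d} :
    nextAwake rank N jump S f = some (w, .justWoken) ↔
      ∃ i, f = some (w, i) ∧ S.awake f = none ∧ w ∉ S.visited ∧
        (∃ g, JumpsDownTo jump S g w) ∧ i < N w := by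
  unfold nextAwake
  cases hf : S.awake f with
  | none =>
    rcases f with _ | ⟨w', i⟩
    · simp
    · constructor
      · intro h
        dsimp only at h
        split_ifs at h with hs
        simp only [Option.some.injEq, Prod.mk.injEq, and_true] at h
        subst h
        exact ⟨i, rfl, rfl, hs⟩
      · rintro ⟨i', h, _, hs⟩
        simp only [Option.some.injEq, Prod.mk.injEq] at h
        obtain ⟨rfl, rfl⟩ := h
        dsimp only
        rw [if_pos hs]
  | some vs =>
    obtain ⟨v, s⟩ := vs
    simp only [reduceCtorEq, false_and, and_false, exists_false, iff_false]
    cases hj : jump f s with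
    | toParent => rcases v with _ | ⟨c', _ | ⟨b, w⟩⟩ <;> simp
    | toChild j => dsimp only; split_ifs <;> simp

/-- The frogs of `S` in mode `s` at `v` are as many as the pending instructions of `u`. -/
structure Matches (N : Vertex d → ℕ) (S : Config d) (u : TokenState d) : Prop where
  visited : S.visited = u.visited
  encard : ∀ v s, {f | S.awake f = some (v, s)}.encard = u.pending v s
  finite : {f | S.awake f ≠ none}.Finite
  dormant : ∀ w i, S.awake (some (w, i)) ≠ none → w ∈ S.visited

/-- Any numbering of the frogs that share a position and a mode will do, since the instructions in
one stack are i.i.d. -/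
theorem Matches.exists_index (h : Matches N S u) :
    ∃ idx : Frog d → ℕ, ∀ v s,
      Set.BijOn idx {f | S.awake f = some (v, s)} (Set.Iio (u.pending v s)) := by
  have : ∀ v s, ∃ g : Frog d → ℕ,
      Set.BijOn g {f | S.awake f = some (v, s)} (Set.Iio (u.pending v s)) := by
    intro v s
    refine Set.Finite.exists_bijOn_of_encard_eq
      (h.finite.subset fun f (hf : _ = _) => by simp [hf]) ?_
    rw [h.encard, ← Finset.coe_range, Set.encard_coe_eq_coe_finsetCard, Finset.card_range]
  choose g hg using this
  refine ⟨fun f => match S.awake f with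
    | some (v, s) => g v s f
    | none => 0, fun v s => (hg v s).congr fun f (hf : _ = _) => ?_⟩
  simp only [hf]

/-- `jump` and `η` prescribe the same jumps, when `idx` numbers the awake frogs. -/
def Agree (S : Config d) (u : TokenState d) (idx : Frog d → ℕ) (jump : Frog d → Mode d → Move d)
    (η : Stack d) : Prop :=
  ∀ f v s, S.awake f = some (v, s) → jump f s = η (v, s, u.used v s + idx f)

/-- Stated for a finite set of vertices to serve twice: a single vertex gives the frogs that return
to its parent, and all children of the root give the root visits. -/
theorem encard_jumpsUp {idx : Frog d → ℕ}
    (hidx : ∀ v s, Set.BijOn idx {f | S.awake f = some (v, s)} (Set.Iio (u.pending v s)))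
    (ha : Agree S u idx jump η) (T : Finset (Vertex d)) :
    {f | ∃ v ∈ T, JumpsUp jump S f v}.encard = (∑ v ∈ T, u.upMoves η v : ℕ) := by
  set F : Finset (Σ _ : Vertex d, Σ _ : Mode d, ℕ) := T.sigma fun v => Finset.univ.sigma fun s =>
    (Finset.range (u.pending v s)).filter fun i => η (v, s, u.used v s + i) = .toParent
  have hF : F.card = ∑ v ∈ T, u.upMoves η v := by
    simp only [F, Finset.card_sigma, TokenState.upMoves]
  set g : Frog d → Σ _ : Vertex d, Σ _ : Mode d, ℕ := fun f => match S.awake f with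
    | some (v, s) => ⟨v, s, idx f⟩
    | none => ⟨[], .movingDown, 0⟩
  have hg : ∀ f v s, S.awake f = some (v, s) → g f = ⟨v, s, idx f⟩ := by
    intro f v s hf
    simp only [g, hf]
  have himg : g '' {f | ∃ v ∈ T, JumpsUp jump S f v} = F := by
    ext ⟨v, s, i⟩
    simp only [Set.mem_image, Set.mem_ofPred_eq, F, Finset.coe_sigma, Set.mem_sigma_iff,
      Finset.mem_coe, Finset.mem_filter, Finset.mem_range, Finset.mem_univ, true_and]
    constructor
    · rintro ⟨f, ⟨v', hv', s', hf, hup⟩, hfe⟩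
      rw [hg f v' s' hf] at hfe
      simp only [Sigma.mk.injEq, heq_eq_eq] at hfe
      obtain ⟨rfl, rfl, rfl⟩ := hfe
      exact ⟨hv', (hidx v' s').mapsTo hf, (ha f v' s' hf).symm.trans hup⟩
    · rintro ⟨hv, hi, hη⟩
      obtain ⟨f, hf, rfl⟩ := (hidx v s).surjOn hi
      exact ⟨f, ⟨v, hv, s, hf, (ha f v s hf).trans hη⟩, hg f v s hf⟩
  have hinj : Set.InjOn g {f | ∃ v ∈ T, JumpsUp jump S f v} := by
    rintro f ⟨v, _, s, hf, _⟩ f' ⟨v', _, s', hf', _⟩ he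
    rw [hg f v s hf, hg f' v' s' hf'] at he
    simp only [Sigma.mk.injEq, heq_eq_eq] at he
    obtain ⟨rfl, rfl, he⟩ := he
    exact (hidx v s).injOn hf hf' he
  rw [← hinj.encard_image, himg, Set.encard_coe_eq_coe_finsetCard, hF]

theorem exists_jumpsDownTo_iff {idx : Frog d → ℕ}
    (hidx : ∀ v s, Set.BijOn idx {f | S.awake f = some (v, s)} (Set.Iio (u.pending v s)))
    (ha : Agree S u idx jump η) (w : Vertex d) :
    (∃ f, JumpsDownTo jump S f w) ↔ u.Reaches η w := by
  constructor
  · rintro ⟨f, v, s, j, hf, hj, rfl⟩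
    exact ⟨v, s, idx f, j, (hidx v s).mapsTo hf, (ha f v s hf).symm.trans hj, rfl⟩
  · rintro ⟨v, s, i, j, hi, hj, rfl⟩
    obtain ⟨f, hf, rfl⟩ := (hidx v s).surjOn hi
    exact ⟨f, v, s, j, hf, (ha f v s hf).trans hj, rfl⟩

/-- Injective ranks leave exactly one survivor at each newly reached vertex. Its label is irrelevant
for the counts, so this is the only trace of the priority order. -/
theorem existsUnique_survivesAt (hrank : Function.Injective rank) {w : Vertex d}
    (hw : w ∉ S.visited) (h : ∃ g, JumpsDownTo jump S g w) :
    ∃ f, {f | SurvivesAt rank jump S f w} = {f} := by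
  obtain ⟨f, hf, hmin⟩ := WellFounded.has_min (measure rank).wf {g | JumpsDownTo jump S g w} h
  have hle : ∀ g, JumpsDownTo jump S g w → rank f ≤ rank g := fun g hg => not_lt.1 (hmin g hg)
  refine ⟨f, Set.eq_singleton_iff_unique_mem.2 ⟨⟨hf, hw, hle⟩, fun g hg => ?_⟩⟩
  exact hrank (le_antisymm (hg.2.2 f hf) (hle g hg.1))

theorem finite_jumpsDownTo (hfin : {f | S.awake f ≠ none}.Finite) :
    {w | ∃ f, JumpsDownTo jump S f w}.Finite := by
  refine (hfin.image fun f => match S.awake f with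
    | some (v, s) => (match jump f s with
      | .toChild j => j :: v
      | .toParent => [])
    | none => []).subset ?_
  rintro w ⟨f, v, s, j, hf, hj, rfl⟩
  exact ⟨f, by simp [hf], by simp [hf, hj]⟩

/-- Only counts per vertex and mode are compared. Finiteness survives because finitely many awake
frogs reach finitely many vertices, each with finitely many dormant frogs; `dormant` ensures that
all frogs at a newly visited vertex are still there to be woken. -/
theorem Matches.next (hrank : Function.Injective rank) (h : Matches N S u) {idx : Frog d → ℕ}
    (hidx : ∀ v s, Set.BijOn idx {f | S.awake f = some (v, s)} (Set.Iio (u.pending v s)))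
    (ha : Agree S u idx jump η) : Matches N (S.next rank N jump) (u.next N η) where
  visited := by
    simp only [Config.next, TokenState.next, h.visited, exists_jumpsDownTo_iff hidx ha]
  encard := by
    intro v s
    simp only [Config.next, TokenState.next]
    cases s with
    | justWoken =>
      simp only [nextAwake_eq_justWoken_iff, exists_jumpsDownTo_iff hidx ha, h.visited]
      split_ifs with hc
      · have : {f | ∃ i, f = some (v, i) ∧ S.awake f = none ∧ v ∉ u.visited ∧ u.Reaches η v ∧
            i < N v} = (fun i => (some (v, i) : Frog d)) '' (Finset.range (N v) : Set ℕ) := by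
          ext f
          simp only [Set.mem_ofPred_eq, Finset.coe_range, Set.mem_image, Set.mem_Iio]
          constructor
          · rintro ⟨i, rfl, _, _, _, hi⟩
            exact ⟨i, hi, rfl⟩
          · rintro ⟨i, hi, rfl⟩
            refine ⟨i, rfl, ?_, hc.1, hc.2, hi⟩
            by_contra hne
            exact hc.1 (h.visited ▸ h.dormant _ _ hne)
        rw [this, Function.Injective.encard_image, Set.encard_coe_eq_coe_finsetCard,
          Finset.card_range]
        intro i j hij
        simpa using hij
      · rw [Nat.cast_zero, Set.encard_eq_zero, Set.eq_empty_iff_forall_notMem]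
        rintro f ⟨i, _, _, h1, h2, _⟩
        exact hc ⟨h1, h2⟩
    | cameUp c =>
      simp only [nextAwake_eq_cameUp_iff]
      rcases v with _ | ⟨b, w⟩
      · simp
      · have := encard_jumpsUp hidx ha {c :: b :: w}
        simpa using this
    | movingDown =>
      simp only [nextAwake_eq_movingDown_iff]
      split_ifs with hc
      · obtain ⟨f, hf⟩ := existsUnique_survivesAt (jump := jump) hrank (h.visited ▸ hc.1)
          ((exists_jumpsDownTo_iff hidx ha v).2 hc.2)
        rw [hf, Set.encard_singleton, Nat.cast_one]
      · rw [Nat.cast_zero, Set.encard_eq_zero, Set.eq_empty_iff_forall_notMem]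
        rintro f ⟨h1, h2, _⟩
        exact hc ⟨h.visited ▸ h2, (exists_jumpsDownTo_iff hidx ha v).1 ⟨f, h1⟩⟩
  finite := by
    have hfin := (finite_jumpsDownTo (jump := jump) h.finite).biUnion fun w _ =>
      (Set.finite_Iio (N w)).image fun i => (some (w, i) : Frog d)
    refine (h.finite.union hfin).subset fun f hf => ?_
    by_contra hn
    simp only [Set.mem_union, not_or, Set.mem_ofPred_eq, not_not] at hn
    refine hf ?_
    change nextAwake rank N jump S f = none
    unfold nextAwake
    rw [hn.1]
    rcases f with _ | ⟨w, i⟩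
    · rfl
    · dsimp only
      rw [if_neg]
      rintro ⟨_, h1, h2⟩
      exact hn.2 (Set.mem_biUnion h1 ⟨i, h2, rfl⟩)
  dormant := by
    intro w i hne
    change nextAwake rank N jump S (some (w, i)) ≠ none at hne
    by_cases hf : S.awake (some (w, i)) = none
    · refine Or.inr ?_
      unfold nextAwake at hne
      rw [hf] at hne
      dsimp only at hne
      split_ifs at hne with hc
      · exact hc.2.1
      · exact absurd rfl hne
    · exact Or.inl (h.dormant w i hf)

end Transfer

/-! ### Root visits have the same law in the frog model and in the stacks -/

section TransferLaw

variable {d : ℕ} (rank : Frog d → ℕ) (N : Vertex d → ℕ)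

/-- The jumps of all frogs at time `t`. -/
abbrev jumpsAt (ω : ℕ × Frog d × Mode d → Move d) (t : ℕ) (f : Frog d) (s : Mode d) : Move d :=
  ω (t, f, s)

/-- The number of jumps to the root in the `k` steps after time `t`, starting from `S`. -/
noncomputable def frogExits (ω : ℕ × Frog d × Mode d → Move d) : ℕ → Config d → ℕ → ℕ∞
  | _, _, 0 => 0
  | t, S, k + 1 => {f | ∃ j : Fin d, JumpsUp (jumpsAt ω t) S f [j]}.encard +
      frogExits ω (t + 1) (S.next rank N (jumpsAt ω t)) k

variable {rank N}

theorem frogExits_congr {ω ω' : ℕ × Frog d × Mode d → Move d} (k : ℕ) :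
    ∀ (t : ℕ) (S : Config d), (∀ i f s, t ≤ i → ω (i, f, s) = ω' (i, f, s)) →
      frogExits rank N ω t S k = frogExits rank N ω' t S k := by
  induction k with
  | zero => exact fun _ _ _ => rfl
  | succ k ih =>
    intro t S h
    have ht : jumpsAt ω t = jumpsAt ω' t := by
      funext f s
      exact h t f s le_rfl
    rw [frogExits, frogExits, ht, ih (t + 1) _ fun i f s hi => h i f s (by omega)]

/-- The numbers of jumps to the root in the frog model and in the stack representation have the same
law. -/
theorem frogExits_law (hrank : Function.Injective rank) (law : Mode d → PMF (Move d)) (k : ℕ) :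
    ∀ (t : ℕ) (S : Config d) (u : TokenState d), Matches N S u → ∀ B : Set ℕ∞,
      MeasurableSet {ω | frogExits rank N ω t S k ∈ B} ∧
      MeasurableSet {η : Stack d | (u.exits N η k : ℕ∞) ∈ B} ∧
      Measure.infinitePi (fun i : ℕ × Frog d × Mode d => (law i.2.2).toMeasure)
          {ω | frogExits rank N ω t S k ∈ B} =
        Measure.infinitePi (fun i : Vertex d × Mode d × ℕ => (law i.2.1).toMeasure)
          {η | (u.exits N η k : ℕ∞) ∈ B} := by
  classical
  induction k with
  | zero =>
    intro t S u _ B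
    simp only [frogExits, TokenState.exits, Nat.cast_zero]
    by_cases h : (0 : ℕ∞) ∈ B
    · simp [h]
    · simp [h]
  | succ k ih =>
    intro t S u hm B
    obtain ⟨idx, hidx⟩ := hm.exists_index
    -- Condition on the jumps of the finitely many awake frogs. They are the coordinates `κ` of the
    -- frog randomness and `κ'` of the stacks; both maps are injective and matching coordinates have
    -- the same law.
    let A := {f // S.awake f ≠ none}
    have : Fintype A := hm.finite.fintype
    have hA : ∀ a : A, ∃ vs : Vertex d × Mode d, S.awake a = some vs :=
      fun a => Option.ne_none_iff_exists'.1 a.2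
    choose pm hpm using hA
    let κ : A → ℕ × Frog d × Mode d := fun a => (t, a, (pm a).2)
    let κ' : A → Vertex d × Mode d × ℕ :=
      fun a => ((pm a).1, (pm a).2, u.used (pm a).1 (pm a).2 + idx a)
    have hκ : Function.Injective κ := by
      intro a b hab
      simp only [κ, Prod.mk.injEq, true_and] at hab
      exact Subtype.ext hab.1
    have hκ' : Function.Injective κ' := by
      rintro a b hab
      simp only [κ', Prod.mk.injEq] at hab
      obtain ⟨h1, h2, h3⟩ := hab
      rw [h1, h2, Nat.add_left_cancel_iff] at h3
      have hv : pm a = pm b := Prod.ext h1 h2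
      exact Subtype.ext ((hidx (pm b).1 (pm b).2).injOn (hv ▸ hpm a) (hpm b) h3)
    -- `J x` and `H x` are deterministic inputs for this step, built from the same jumps `x`. Their
    -- default value `.toParent` is never read.
    let J : (A → Move d) → Frog d → Mode d → Move d :=
      fun x f _ => if h : S.awake f ≠ none then x ⟨f, h⟩ else .toParent
    let H : (A → Move d) → Stack d := fun x => Function.extend κ' x fun _ => .toParent
    have hJ : ∀ x ω, (∀ a, ω (κ a) = x a) → ∀ f v s, S.awake f = some (v, s) →
        jumpsAt ω t f s = J x f s := by
      intro x ω hx f v s hf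
      have hne : S.awake f ≠ none := by simp [hf]
      have hpf : pm ⟨f, hne⟩ = (v, s) := Option.some.inj ((hpm ⟨f, hne⟩).symm.trans hf)
      have := hx ⟨f, hne⟩
      simp only [κ, hpf] at this
      simp only [J, hne, ne_eq, not_false_eq_true, dif_pos]
      exact this
    have hH : ∀ x (η : Stack d), (∀ a, η (κ' a) = x a) → ∀ v s i, i < u.pending v s →
        η (v, s, u.used v s + i) = H x (v, s, u.used v s + i) := by
      intro x η hx v s i hi
      obtain ⟨f, hf, rfl⟩ := (hidx v s).surjOn hi
      have hne : S.awake f ≠ none := by rw [show S.awake f = _ from hf]; simp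
      have hpf : pm ⟨f, hne⟩ = (v, s) := Option.some.inj ((hpm ⟨f, hne⟩).symm.trans hf)
      have hk : κ' ⟨f, hne⟩ = (v, s, u.used v s + idx f) := by simp only [κ', hpf]
      rw [← hk, hx]
      exact (hκ'.extend_apply _ _ _).symm
    have hagree : ∀ x, Agree S u idx (J x) (H x) := by
      intro x f v s hf
      have hne : S.awake f ≠ none := by simp [hf]
      have hpf : pm ⟨f, hne⟩ = (v, s) := Option.some.inj ((hpm ⟨f, hne⟩).symm.trans hf)
      have hk : κ' ⟨f, hne⟩ = (v, s, u.used v s + idx f) := by simp only [κ', hpf]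
      rw [← hk]
      simp only [J, hne, ne_eq, not_false_eq_true, dif_pos]
      exact (hκ'.extend_apply _ _ _).symm
    let c : (A → Move d) → ℕ∞ := fun x => {f | ∃ j : Fin d, JumpsUp (J x) S f [j]}.encard
    have hc : ∀ x, c x = (∑ j : Fin d, u.upMoves (H x) [j] : ℕ) := by
      intro x
      have := encard_jumpsUp hidx (hagree x) (Finset.univ.image fun j : Fin d => [j])
      rw [Finset.sum_image (by intro i _ j _ h; simpa using h)] at this
      simp only [Finset.mem_image, Finset.mem_univ, true_and] at this
      rw [← this]
      simp only [c]
      congr 1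
      ext f
      simp
    -- The `c x` exits of this step shift the target set. This is why the induction runs over all
    -- sets `B`.
    let G : (A → Move d) → Set (ℕ × Frog d × Mode d → Move d) := fun x =>
      {ω | frogExits rank N ω (t + 1) (S.next rank N (J x)) k ∈ {y | c x + y ∈ B}}
    let G' : (A → Move d) → Set (Stack d) := fun x =>
      {η | ((u.next N (H x)).exits N η k : ℕ∞) ∈ {y | c x + y ∈ B}}
    have hnext : ∀ x, Matches N (S.next rank N (J x)) (u.next N (H x)) :=
      fun x => hm.next hrank hidx (hagree x)
    have h1 := infinitePi_eq_sum_of_finite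
      (fun i : ℕ × Frog d × Mode d => (law i.2.2).toMeasure) κ hκ
      {ω | frogExits rank N ω t S (k + 1) ∈ B} G (fun x => (ih _ _ _ (hnext x) _).1)
      (fun x ω hx => by
        have e1 := jumpsUp_congr (hJ x ω hx)
        have e2 := config_next_congr (rank := rank) (N := N) (hJ x ω hx)
        simp only [Set.mem_ofPred_eq, frogExits, G, c, e1, e2])
      (fun x y z hyz hy => by
        have := frogExits_congr (rank := rank) (N := N) (ω := y) (ω' := z) k (t + 1)
          (S.next rank N (J x)) (fun i f s hi => hyz _ (by
            rintro ⟨a, ha⟩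
            simp only [κ, Prod.mk.injEq] at ha
            omega))
        simp only [G, Set.mem_ofPred_eq] at hy ⊢
        rwa [← this])
    have h2 := infinitePi_eq_sum_of_finite
      (fun i : Vertex d × Mode d × ℕ => (law i.2.1).toMeasure) κ' hκ'
      {η | (u.exits N η (k + 1) : ℕ∞) ∈ B} G' (fun x => (ih (t + 1) _ _ (hnext x) _).2.1)
      (fun x η hx => by
        have e1 := TokenState.upMoves_congr (hH x η hx)
        have e2 := TokenState.next_congr (N := N) (hH x η hx)
        simp only [Set.mem_ofPred_eq, TokenState.exits, G', hc, e1, e2, Nat.cast_add])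
      (fun x y z hyz hy => by
        have := TokenState.exits_congr (N := N) (η := y) (η' := z) k (u.next N (H x))
          (fun v s j hj => hyz _ (by
            rintro ⟨a, ha⟩
            simp only [κ', Prod.mk.injEq] at ha
            obtain ⟨rfl, rfl, rfl⟩ := ha
            have := (hidx (pm a).1 (pm a).2).mapsTo (hpm a)
            simp only [TokenState.next, Set.mem_Iio] at hj this
            omega))
        simp only [G', Set.mem_ofPred_eq] at hy ⊢
        rwa [← this])
    refine ⟨h1.1, h2.1, ?_⟩
    rw [h1.2, h2.2]
    exact Finset.sum_congr rfl fun x _ => by rw [(ih (t + 1) _ _ (hnext x) _).2.2]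

/-- The initial state of the stack representation. -/
def TokenState.init (d : ℕ) : TokenState d where
  used _ _ := 0
  pending v s := match s, v with
    | .movingDown, [] => 1
    | _, _ => 0
  visited := {[]}

theorem matches_init : Matches N (Config.init d) (TokenState.init d) where
  visited := rfl
  encard := by
    intro v s
    by_cases h : v = [] ∧ s = .movingDown
    · obtain ⟨rfl, rfl⟩ := h
      have : {f | (Config.init d).awake f = some ([], Mode.movingDown)} = {none} := by
        ext f
        cases f <;> simp [Config.init]
      rw [this]
      simp [TokenState.init]
    · have : {f | (Config.init d).awake f = some (v, s)} = ∅ := by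
        ext f
        cases f with
        | none =>
          simp only [Config.init, Set.mem_ofPred_eq, Option.some.injEq, Prod.mk.injEq,
            Set.mem_empty_iff_false, iff_false]
          rintro ⟨rfl, rfl⟩
          exact h ⟨rfl, rfl⟩
        | some _ => simp [Config.init]
      rw [this, Set.encard_empty]
      cases s <;> cases v <;> simp_all [TokenState.init]
  finite := by
    refine (Set.finite_singleton none).subset fun f hf => ?_
    cases f
    · rfl
    · exact absurd rfl hf
  dormant w i h := absurd rfl h

/-- The number of visits to the root before time `T`. -/
noncomputable def visitsBefore (rank : Frog d → ℕ) (ω : Sample d) (T : ℕ) : ℕ∞ :=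
  Set.encard {x : ℕ × Frog d | x.1 < T ∧
    ∃ j : Fin d, JumpsUp (fun f s => ω.2 (x.1, f, s)) (config rank ω x.1) x.2 [j]}

theorem frogExits_config (ω : Sample d) (k : ℕ) : ∀ t,
    frogExits rank ω.1 ω.2 t (config rank ω t) k = ∑ i ∈ Finset.range k,
      {f | ∃ j : Fin d, JumpsUp (jumpsAt ω.2 (t + i)) (config rank ω (t + i)) f [j]}.encard := by
  induction k with
  | zero => intro t; simp [frogExits]
  | succ k ih =>
    intro t
    rw [frogExits, Finset.sum_range_succ', add_comm]
    congr 1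
    have := ih (t + 1)
    rw [config] at this
    rw [this]
    refine Finset.sum_congr rfl fun i _ => ?_
    rw [show t + 1 + i = t + (i + 1) by omega]

theorem visitsBefore_eq (ω : Sample d) (T : ℕ) :
    visitsBefore rank ω T = frogExits rank ω.1 ω.2 0 (Config.init d) T := by
  rw [show Config.init d = config rank ω 0 from rfl, frogExits_config]
  simp only [zero_add]
  induction T with
  | zero => simp [visitsBefore]
  | succ T ih =>
    rw [Finset.sum_range_succ, ← ih]
    set E := {f | ∃ j : Fin d, JumpsUp (jumpsAt ω.2 T) (config rank ω T) f [j]}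
    have h1 : E.encard = ((fun f => (T, f)) '' E).encard :=
      (Function.Injective.encard_image (fun f g h => (Prod.mk.inj h).2) E).symm
    rw [h1, visitsBefore, visitsBefore, ← Set.encard_union_eq]
    · congr 1
      ext ⟨i, f⟩
      simp only [Set.mem_ofPred_eq, Set.mem_union, Set.mem_image, Prod.mk.injEq, E]
      constructor
      · rintro ⟨hi, h⟩
        rcases Nat.lt_succ_iff_lt_or_eq.1 hi with hi | rfl
        · exact Or.inl ⟨hi, h⟩
        · exact Or.inr ⟨f, h, rfl, rfl⟩
      · rintro (⟨hi, h⟩ | ⟨f, h, rfl, rfl⟩)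
        · exact ⟨hi.trans (Nat.lt_succ_self _), h⟩
        · exact ⟨Nat.lt_succ_self _, h⟩
    · rw [Set.disjoint_left]
      rintro ⟨i, f⟩ ⟨hi, _⟩ ⟨g, _, hg⟩
      simp only [Prod.mk.injEq] at hg
      have : T = i := hg.1
      simp only at hi
      omega

theorem le_encard_iff {α : Type*} (s : Set α) (m : ℕ) :
    (m : ℕ∞) ≤ s.encard ↔ ∃ F : Finset α, F.card = m ∧ ∀ x ∈ F, x ∈ s := by
  constructor
  · intro h
    obtain ⟨t, hts, ht⟩ := Set.exists_subset_encard_eq h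
    have hfin : t.Finite := Set.finite_of_encard_eq_coe ht
    refine ⟨hfin.toFinset, ?_, fun x hx => hts (hfin.mem_toFinset.1 hx)⟩
    rw [hfin.encard_eq_coe_toFinset_card] at ht
    exact_mod_cast ht
  · rintro ⟨F, rfl, hF⟩
    rw [← Set.encard_coe_eq_coe_finsetCard]
    exact Set.encard_le_encard hF

/-- Any `m` root visits have a latest time, so they occur within finitely many steps. -/
theorem le_rootVisits_iff (ω : Sample d) (m : ℕ) :
    m ≤ rootVisits rank ω ↔ ∃ T, m ≤ visitsBefore rank ω T := by
  constructor
  · intro h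
    obtain ⟨F, hF, hFs⟩ := (le_encard_iff _ _).1 h
    refine ⟨F.sup Prod.fst + 1, (le_encard_iff _ _).2 ⟨F, hF, fun x hx => ⟨?_, hFs x hx⟩⟩⟩
    exact Nat.lt_succ_of_le (Finset.le_sup (f := Prod.fst) hx)
  · rintro ⟨T, hT⟩
    exact hT.trans (Set.encard_le_encard fun x hx => hx.2)

/-- For given numbers of frogs, the law of the number of root visits in the stack representation. -/
theorem measure_le_rootVisits (hrank : Function.Injective rank) (law : Mode d → PMF (Move d))
    (N : Vertex d → ℕ) (m : ℕ) :
    Measure.infinitePi (fun i : ℕ × Frog d × Mode d => (law i.2.2).toMeasure)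
        {ω | m ≤ rootVisits rank (N, ω)} =
      Measure.infinitePi (fun i : Vertex d × Mode d × ℕ => (law i.2.1).toMeasure)
        {η | ∃ T, m ≤ (TokenState.init d).exits N η T} := by
  have hset : {ω | m ≤ rootVisits rank (N, ω)} =
      ⋃ T, {ω | frogExits rank N ω 0 (Config.init d) T ∈ {y | (m : ℕ∞) ≤ y}} := by
    ext ω
    simp only [Set.mem_ofPred_eq, Set.mem_iUnion, le_rootVisits_iff, visitsBefore_eq]
  have hset' : {η | ∃ T, m ≤ (TokenState.init d).exits N η T} =
      ⋃ T, {η : Stack d | ((TokenState.init d).exits N η T : ℕ∞) ∈ {y | (m : ℕ∞) ≤ y}} := by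
    ext η
    simp only [Set.mem_ofPred_eq, Set.mem_iUnion, Nat.cast_le]
  have hmono : Monotone fun T =>
      {ω | frogExits rank N ω 0 (Config.init d) T ∈ {y | (m : ℕ∞) ≤ y}} := by
    intro T T' h ω hω
    simp only [Set.mem_ofPred_eq] at hω ⊢
    have e : ∀ T, frogExits rank N ω 0 (Config.init d) T = visitsBefore rank (N, ω) T :=
      fun T => (visitsBefore_eq (N, ω) T).symm
    rw [e] at hω ⊢
    exact hω.trans (Set.encard_le_encard fun x hx => ⟨hx.1.trans_le h, hx.2⟩)
  have hexits : ∀ (η : Stack d) (T : ℕ) (u : TokenState d), u.exits N η T ≤ u.exits N η (T + 1) := by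
    intro η T
    induction T with
    | zero => intro u; simp [TokenState.exits]
    | succ T ih =>
      intro u
      rw [TokenState.exits, TokenState.exits]
      exact Nat.add_le_add_left (ih _) _
  have hmono' : Monotone fun T =>
      {η : Stack d | ((TokenState.init d).exits N η T : ℕ∞) ∈ {y | (m : ℕ∞) ≤ y}} := by
    intro T T' h η hη
    simp only [Set.mem_ofPred_eq, Nat.cast_le] at hη ⊢
    exact hη.trans (monotone_nat_of_le_succ (fun T => hexits η T _) h)
  rw [hset, hset', hmono.measure_iUnion, hmono'.measure_iUnion]
  exact iSup_congr fun T => (frogExits_law hrank law T 0 _ _ matches_init _).2.2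

end TransferLaw

/-! ### Measurability of the number of root visits -/

section Measurability

variable {d : ℕ} {rank : Frog d → ℕ}

/-- The state of each frog and vertex is a measurable function of the randomness. -/
structure MeasurableConfig (S : Sample d → Config d) : Prop where
  visited : ∀ w, Measurable fun ω => w ∈ (S ω).visited
  awake : ∀ f x, Measurable fun ω => (S ω).awake f = x

theorem measurable_jump_eq (t : ℕ) (f : Frog d) (s : Mode d) (m : Move d) :
    Measurable fun ω : Sample d => ω.2 (t, f, s) = m :=
  measurableSet_setOfPred.1 <| (measurableSet_singleton m).preimage
    ((measurable_pi_apply (t, f, s)).comp measurable_snd)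

theorem MeasurableConfig.jumpsUp {S : Sample d → Config d} (h : MeasurableConfig S) (t : ℕ)
    (f : Frog d) (v : Vertex d) :
    Measurable fun ω => JumpsUp (fun f s => ω.2 (t, f, s)) (S ω) f v :=
  .exists fun s => (h.awake _ _).and (measurable_jump_eq t f s _)

theorem MeasurableConfig.jumpsDownTo {S : Sample d → Config d} (h : MeasurableConfig S) (t : ℕ)
    (f : Frog d) (w : Vertex d) :
    Measurable fun ω => JumpsDownTo (fun f s => ω.2 (t, f, s)) (S ω) f w :=
  .exists fun _ => .exists fun s => .exists fun _ =>
    (h.awake _ _).and ((measurable_jump_eq t f s _).and measurable_const)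

theorem MeasurableConfig.survivesAt {S : Sample d → Config d} (h : MeasurableConfig S) (t : ℕ)
    (f : Frog d) (w : Vertex d) :
    Measurable fun ω => SurvivesAt rank (fun f s => ω.2 (t, f, s)) (S ω) f w :=
  (h.jumpsDownTo t f w).and ((h.visited w).not.and
    (.forall fun g => (h.jumpsDownTo t g w).imp measurable_const))

theorem MeasurableConfig.next {S : Sample d → Config d} (h : MeasurableConfig S) (t : ℕ) :
    MeasurableConfig fun ω => (S ω).next rank ω.1 fun f s => ω.2 (t, f, s) where
  visited w := by
    have : Measurable fun ω => w ∈ (S ω).visited ∨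
      ∃ f, JumpsDownTo (fun f s => ω.2 (t, f, s)) (S ω) f w :=
      (h.visited w).or (.exists fun f => h.jumpsDownTo t f w)
    exact this
  awake f x := by
    have hsome : ∀ v s, Measurable fun ω => nextAwake rank ω.1 (fun f s => ω.2 (t, f, s)) (S ω) f
        = some (v, s) := by
      intro v s
      cases s with
      | justWoken =>
        simp only [nextAwake_eq_justWoken_iff]
        refine .exists fun i => measurable_const.and ((h.awake _ _).and
          ((h.visited v).not.and ((Measurable.exists fun g => h.jumpsDownTo t g v).and ?_)))
        exact measurableSet_setOfPred.1
          (measurableSet_lt measurable_const ((measurable_pi_apply v).comp measurable_fst))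
      | cameUp c =>
        simp only [nextAwake_eq_cameUp_iff]
        exact measurable_const.and (h.jumpsUp t f _)
      | movingDown =>
        simp only [nextAwake_eq_movingDown_iff]
        exact h.survivesAt t f v
    cases x with
    | some vs => exact hsome vs.1 vs.2
    | none =>
      have : ∀ ω : Sample d, (nextAwake rank ω.1 (fun f s => ω.2 (t, f, s)) (S ω) f = none) ↔
          ∀ v s, ¬ nextAwake rank ω.1 (fun f s => ω.2 (t, f, s)) (S ω) f = some (v, s) := by
        intro ω
        rw [Option.eq_none_iff_forall_ne_some, Prod.forall]
      change Measurable fun ω => nextAwake rank ω.1 (fun f s => ω.2 (t, f, s)) (S ω) f = none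
      simp only [this]
      exact .forall fun v => .forall fun s => (hsome v s).not

theorem measurableConfig_config (t : ℕ) : MeasurableConfig fun ω => config rank ω t := by
  induction t with
  | zero =>
    exact ⟨fun _ => measurable_const,
      fun f x => measurable_const (a := (Config.init d).awake f = x)⟩
  | succ t ih => exact ih.next t

/-- Having at least `m` visits means that some set of `m` pairs of a time and a frog consists of
visits, and there are only countably many finite sets of pairs. -/
theorem measurable_rootVisits : Measurable (rootVisits rank) := by
  refine measurable_of_tails fun m => ?_
  simp only [rootVisits, le_encard_iff]
  refine measurableSet_setOfPred.2 (.exists fun F => measurable_const.and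
    (.forall fun x => Measurable.imp measurable_const ?_))
  exact .exists fun j => (measurableConfig_config x.1).jumpsUp x.1 x.2 [j]

end Measurability

/-! ### Exploration at a single vertex -/

section Explore

variable {d : ℕ}

/-- The instructions for the first `n` frogs that return from the child `c`. -/
def returns (c : Fin d) (n : ℕ) : List (Mode d × ℕ) := (List.range n).map fun j => (.cameUp c, j)

/-- The number of frogs that leave a vertex to its parent, when the instructions in the list are
pending, the children in `K` have been visited, and `w c` frogs return from the child `c` when it is
visited. The instructions are executed one by one. -/
def explore (ζ : Mode d × ℕ → Move d) (w : Fin d → ℕ) : Finset (Fin d) → List (Mode d × ℕ) → ℕ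
  | _, [] => 0
  | K, τ :: L =>
    match ζ τ with
    | .toParent => explore ζ w K L + 1
    | .toChild c =>
      if c ∈ K then explore ζ w K L else explore ζ w (insert c K) (L ++ returns c (w c))
-- The list may grow, but only when a new child is opened, which happens at most `d` times.
termination_by K L => (Kᶜ.card, L.length)
decreasing_by
  · exact Prod.Lex.right _ (by simp)
  · exact Prod.Lex.right _ (by simp)
  · refine Prod.Lex.left _ _ (Finset.card_lt_card ?_)
    rw [Finset.compl_ssubset_compl]
    exact Finset.ssubset_insert ‹_›

/-- Induction along the steps of `explore`. -/
theorem explore_induction {P : Finset (Fin d) → List (Mode d × ℕ) → Prop}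
    (nil : ∀ K, P K [])
    (cons : ∀ K τ L, P K L → (∀ c ∉ K, ∀ L', P (insert c K) L') → P K (τ :: L)) :
    ∀ K L, P K L := by
  have : ∀ n, ∀ K : Finset (Fin d), Kᶜ.card = n → ∀ L, P K L := by
    intro n
    induction n using Nat.strong_induction_on with
    | _ n ih =>
      intro K hK L
      induction L with
      | nil => exact nil K
      | cons τ L ihL =>
        refine cons K τ L ihL fun c hc L' => ih _ ?_ _ rfl L'
        rw [← hK]
        refine Finset.card_lt_card ?_
        rw [Finset.compl_ssubset_compl]
        exact Finset.ssubset_insert hc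
  exact fun K => this _ K rfl

theorem mem_returns {c : Fin d} {n : ℕ} {τ : Mode d × ℕ} :
    τ ∈ returns c n ↔ ∃ j < n, τ = (.cameUp c, j) := by
  simp only [returns, List.mem_map, List.mem_range, eq_comm]

/-- `F` is the set of children eventually visited. It is the least set containing `K` and closed
under the instructions that become readable, and the exits are counted from `F` alone; hence the
order of execution does not matter. -/
theorem explore_spec (ζ : Mode d × ℕ → Move d) (w : Fin d → ℕ) (K : Finset (Fin d))
    (L : List (Mode d × ℕ)) :
    ∃ F : Finset (Fin d), K ⊆ F ∧ (∀ τ ∈ L, ∀ c, ζ τ = .toChild c → c ∈ F) ∧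
      (∀ c ∈ F, c ∉ K → ∀ τ ∈ returns c (w c), ∀ c', ζ τ = .toChild c' → c' ∈ F) ∧
      explore ζ w K L = L.countP (ζ · = .toParent) +
        ∑ c ∈ F \ K, (returns c (w c)).countP (ζ · = .toParent) ∧
      ∀ F' : Finset (Fin d), K ⊆ F' → (∀ τ ∈ L, ∀ c, ζ τ = .toChild c → c ∈ F') →
        (∀ c ∈ F', c ∉ K → ∀ τ ∈ returns c (w c), ∀ c', ζ τ = .toChild c' → c' ∈ F') →
        F ⊆ F' := by
  revert K L
  refine explore_induction (fun K => ?_) fun K τ L ih1 ih2 => ?_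
  · refine ⟨K, subset_rfl, by simp, fun c hc hc' => absurd hc hc', by simp [explore],
      fun F' h _ _ => h⟩
  · cases hτ : ζ τ with
    | toParent =>
      obtain ⟨F, h1, h2, h3, h4, h5⟩ := ih1
      refine ⟨F, h1, ?_, h3, ?_, fun F' g1 g2 g3 => h5 F' g1 (fun τ' h' => g2 τ' (by simp [h'])) g3⟩
      · intro τ' hτ' c hc
        rcases List.mem_cons.1 hτ' with rfl | h
        · rw [hτ] at hc; cases hc
        · exact h2 τ' h c hc
      · rw [explore, hτ]
        simp only [h4, List.countP_cons, hτ, decide_true, if_true]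
        ring
    | toChild c =>
      by_cases hc : c ∈ K
      · obtain ⟨F, h1, h2, h3, h4, h5⟩ := ih1
        refine ⟨F, h1, ?_, h3, ?_, fun F' g1 g2 g3 =>
          h5 F' g1 (fun τ' h' => g2 τ' (by simp [h'])) g3⟩
        · intro τ' hτ' c' hc'
          rcases List.mem_cons.1 hτ' with rfl | h
          · rw [hτ] at hc'
            cases hc'
            exact h1 hc
          · exact h2 τ' h c' hc'
        · rw [explore, hτ]
          simp [h4, hτ, hc]
      · obtain ⟨F, h1, h2, h3, h4, h5⟩ := ih2 c hc (L ++ returns c (w c))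
        have hcF : c ∈ F := h1 (Finset.mem_insert_self _ _)
        refine ⟨F, (Finset.subset_insert _ _).trans h1, ?_, ?_, ?_, fun F' g1 g2 g3 => ?_⟩
        · intro τ' hτ' c' hc'
          rcases List.mem_cons.1 hτ' with rfl | h
          · rw [hτ] at hc'
            cases hc'
            exact hcF
          · exact h2 τ' (List.mem_append_left _ h) c' hc'
        · intro a ha haK τ' hτ' c' hc'
          by_cases hac : a = c
          · subst hac
            exact h2 τ' (List.mem_append_right _ hτ') c' hc'
          · exact h3 a ha (by simp [hac, haK]) τ' hτ' c' hc'
        · have hF : F \ K = insert c (F \ insert c K) := by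
            ext a
            simp only [Finset.mem_sdiff, Finset.mem_insert, not_or]
            constructor
            · rintro ⟨ha, haK⟩
              by_cases hac : a = c
              · exact Or.inl hac
              · exact Or.inr ⟨ha, hac, haK⟩
            · rintro (rfl | ⟨ha, _, haK⟩)
              · exact ⟨hcF, hc⟩
              · exact ⟨ha, haK⟩
          rw [explore, hτ, hF, Finset.sum_insert (by simp)]
          simp only [hc, if_false, h4, List.countP_append, List.countP_cons, hτ, reduceCtorEq,
            decide_false, Bool.false_eq_true]
          ring
        · have hcF' : c ∈ F' := g2 τ (by simp) c hτ
          refine h5 F' (Finset.insert_subset hcF' g1) ?_ ?_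
          · intro τ' hτ' c' hc'
            rcases List.mem_append.1 hτ' with h | h
            · exact g2 τ' (by simp [h]) c' hc'
            · exact g3 c hcF' hc τ' h c' hc'
          · intro a ha haK
            exact g3 a ha fun h => haK (Finset.mem_insert_of_mem h)

/-- The number of instructions for each mode that are executed at a vertex with `n` frogs, if the
children in `K` are visited. -/
def avail (n : ℕ) (w : Fin d → ℕ) (K : Finset (Fin d)) : Mode d → ℕ
  | .movingDown => 1
  | .justWoken => n
  | .cameUp c => if c ∈ K then w c else 0

/-- The number of instructions pointing to the parent among the first `a s` for each mode `s`. -/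
def ups (ζ : Mode d × ℕ → Move d) (a : Mode d → ℕ) : ℕ :=
  ∑ s, ((Finset.range (a s)).filter fun i => ζ (s, i) = .toParent).card

/-- No available instruction leads out of `K`. -/
def IsClosedUnder (ζ : Mode d × ℕ → Move d) (a : Mode d → ℕ) (K : Finset (Fin d)) : Prop :=
  ∀ s i c, i < a s → ζ (s, i) = .toChild c → c ∈ K

/-- The number of frogs that leave to the parent a vertex with `n` frogs, once it is visited, if `w c`
frogs return from the child `c` when it is visited. -/
def localExits (ζ : Mode d × ℕ → Move d) (n : ℕ) (w : Fin d → ℕ) : ℕ :=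
  explore ζ w ∅ ((.movingDown, 0) :: (List.range n).map fun i => (.justWoken, i))

theorem ups_mono (ζ : Mode d × ℕ → Move d) {a a' : Mode d → ℕ} (h : ∀ s, a s ≤ a' s) :
    ups ζ a ≤ ups ζ a' :=
  Finset.sum_le_sum fun s _ => Finset.card_le_card <|
    Finset.filter_subset_filter _ (Finset.range_mono (h s))

theorem sum_mode (f : Mode d → ℕ) :
    ∑ s, f s = f .movingDown + f .justWoken + ∑ c, f (.cameUp c) := by
  rw [← (modeEquiv d).sum_comp, Fintype.sum_option, Fintype.sum_option]
  simp only [modeEquiv, Equiv.coe_fn_mk]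
  ring

theorem countP_map_range (ζ : Mode d × ℕ → Move d) (s : Mode d) (n : ℕ) :
    ((List.range n).map fun i => (s, i)).countP (ζ · = .toParent) =
      ((Finset.range n).filter fun i => ζ (s, i) = .toParent).card := by
  rw [List.countP_map, ← Nat.count_eq_card_filter_range, Nat.count]
  rfl

/-- Describes the exits without reference to an order of execution, in the same terms as the
simultaneous dynamics, so that the two can be compared. -/
theorem localExits_spec (ζ : Mode d × ℕ → Move d) (n : ℕ) (w : Fin d → ℕ) :
    ∃ K, IsClosedUnder ζ (avail n w K) K ∧ localExits ζ n w = ups ζ (avail n w K) ∧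
      ∀ K', IsClosedUnder ζ (avail n w K') K' → K ⊆ K' := by
  obtain ⟨F, _, h2, h3, h4, h5⟩ :=
    explore_spec ζ w ∅ ((.movingDown, 0) :: (List.range n).map fun i => (.justWoken, i))
  refine ⟨F, ?_, ?_, fun K' hK' => h5 K' (Finset.empty_subset _) ?_ ?_⟩
  · rintro (_ | c | _) i c' hi hc'
    · exact h2 _ (by simpa [avail] using hi) c' hc'
    · by_cases hc : c ∈ F
      · simp only [avail, hc, if_true] at hi
        exact h3 c hc (by simp) _ (mem_returns.2 ⟨i, hi, rfl⟩) c' hc'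
      · simp [avail, hc] at hi
    · have : i = 0 := by simpa [avail] using hi
      subst this
      exact h2 _ (by simp) c' hc'
  · rw [localExits, h4, ups, sum_mode, List.countP_cons, countP_map_range]
    simp only [returns, countP_map_range, avail]
    have h1 : (∑ c, ((Finset.range (if c ∈ F then w c else 0)).filter
        fun i => ζ (.cameUp c, i) = .toParent).card) = ∑ c ∈ F \ ∅,
          ((Finset.range (w c)).filter fun i => ζ (.cameUp c, i) = .toParent).card := by
      rw [Finset.sdiff_empty, ← Finset.sum_filter_add_sum_filter_not Finset.univ (· ∈ F),
        Finset.filter_univ_mem]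
      have : ∀ c ∈ Finset.univ.filter (· ∉ F), ((Finset.range (if c ∈ F then w c else 0)).filter
          fun i => ζ (.cameUp c, i) = .toParent).card = 0 := by
        intro c hc
        simp [(Finset.mem_filter.1 hc).2]
      rw [Finset.sum_eq_zero this, add_zero]
      exact Finset.sum_congr rfl fun c hc => by simp [hc]
    have h2 : ((Finset.range 1).filter fun i => ζ (.movingDown, i) = .toParent).card =
        if ζ (.movingDown, 0) = .toParent then 1 else 0 := by
      rw [Finset.range_one, Finset.filter_singleton]
      split_ifs <;> simp
    rw [h1, h2]
    simp only [decide_eq_true_eq]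
    ring
  · intro τ hτ c hc
    rcases List.mem_cons.1 hτ with rfl | h
    · exact hK' .movingDown 0 c (by simp [avail]) hc
    · obtain ⟨i, hi, rfl⟩ := List.mem_map.1 h
      exact hK' .justWoken i c (by simpa [avail] using hi) hc
  · intro c hcK _ τ hτ c' hc'
    obtain ⟨i, hi, rfl⟩ := mem_returns.1 hτ
    exact hK' (.cameUp c) i c' (by simpa [avail, hcK] using hi) hc'

theorem avail_mono {n : ℕ} {w w' : Fin d → ℕ} (hw : ∀ c, w c ≤ w' c) {K K' : Finset (Fin d)}
    (hK : K ⊆ K') (s : Mode d) : avail n w K s ≤ avail n w' K' s := by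
  cases s with
  | justWoken => exact le_rfl
  | movingDown => exact le_rfl
  | cameUp c =>
    simp only [avail]
    split_ifs with h1 h2
    · exact hw c
    · exact absurd (hK h1) h2
    · exact Nat.zero_le _
    · exact le_rfl

theorem IsClosedUnder.anti {ζ : Mode d × ℕ → Move d} {a a' : Mode d → ℕ} {K : Finset (Fin d)}
    (h : IsClosedUnder ζ a' K) (ha : ∀ s, a s ≤ a' s) : IsClosedUnder ζ a K :=
  fun s i c hi hc => h s i c (hi.trans_le (ha s)) hc

/-- More returning frogs make being closed more demanding, so the least closed set grows, and with
it the set of executed instructions. -/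
theorem localExits_mono (ζ : Mode d × ℕ → Move d) (n : ℕ) {w w' : Fin d → ℕ}
    (hw : ∀ c, w c ≤ w' c) : localExits ζ n w ≤ localExits ζ n w' := by
  obtain ⟨K, _, h2, h3⟩ := localExits_spec ζ n w
  obtain ⟨K', g1, g2, _⟩ := localExits_spec ζ n w'
  rw [h2, g2]
  have hKK' : K ⊆ K' := h3 K' (g1.anti (avail_mono hw subset_rfl))
  exact ups_mono ζ (avail_mono hw hKK')

end Explore

/-! ### The abelian property: simultaneous dynamics against recursive exploration -/

section Availability

variable {d : ℕ} (N : Vertex d → ℕ) (η : Stack d)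

/-- The instructions at `v`. -/
abbrev Stack.instr (η : Stack d) (v : Vertex d) : Mode d × ℕ → Move d := fun x => η (v, x.1, x.2)

/-- The number of frogs that leave `v` to its parent after `v` is visited, if only the next `n` levels
below `v` are taken into account. -/
def subtreeExits : ℕ → Vertex d → ℕ
  | 0, _ => 0
  | n + 1, v => localExits (η.instr v) (N v) fun c => subtreeExits n (c :: v)

/-- Some available instruction points down to `w`. -/
def Pointed (a : Vertex d → Mode d → ℕ) (w : Vertex d) : Prop :=
  ∃ v s i j, i < a v s ∧ η (v, s, i) = .toChild j ∧ w = j :: v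

open Classical in
/-- The instructions that become available by executing those in `a`. -/
noncomputable def advance (a : Vertex d → Mode d → ℕ) : Vertex d → Mode d → ℕ
  | b :: w, .cameUp c => ups (η.instr (c :: b :: w)) (a (c :: b :: w))
  | [], .cameUp _ => 0
  | w, .justWoken => if Pointed η a w then N w else 0
  | w, .movingDown => if w = [] ∨ Pointed η a w then 1 else 0

variable {N η}

theorem not_pointed_nil {a : Vertex d → Mode d → ℕ} : ¬ Pointed η a [] := by
  rintro ⟨v, s, i, j, _, _, h⟩
  cases h

theorem Pointed.mono {a a' : Vertex d → Mode d → ℕ} (h : ∀ v s, a v s ≤ a' v s) {w : Vertex d}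
    (hw : Pointed η a w) : Pointed η a' w := by
  obtain ⟨v, s, i, j, hi, hj, rfl⟩ := hw
  exact ⟨v, s, i, j, hi.trans_le (h v s), hj, rfl⟩

theorem advance_cameUp {a : Vertex d → Mode d → ℕ} {v : Vertex d} (hv : v ≠ []) (c : Fin d) :
    advance N η a v (.cameUp c) = ups (η.instr (c :: v)) (a (c :: v)) := by
  cases v with
  | nil => exact absurd rfl hv
  | cons b w => rfl

theorem advance_cameUp_nil {a : Vertex d → Mode d → ℕ} (c : Fin d) :
    advance N η a [] (.cameUp c) = 0 := rfl

theorem advance_justWoken {a : Vertex d → Mode d → ℕ} (v : Vertex d) [Decidable (Pointed η a v)] :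
    advance N η a v .justWoken = if Pointed η a v then N v else 0 := by
  cases v <;> simp only [advance] <;> congr

theorem advance_movingDown {a : Vertex d → Mode d → ℕ} (v : Vertex d)
    [Decidable (v = [] ∨ Pointed η a v)] :
    advance N η a v .movingDown = if v = [] ∨ Pointed η a v then 1 else 0 := by
  cases v <;> simp only [advance] <;> congr

theorem advance_mono {a a' : Vertex d → Mode d → ℕ} (h : ∀ v s, a v s ≤ a' v s) (v : Vertex d)
    (s : Mode d) : advance N η a v s ≤ advance N η a' v s := by
  classical
  cases s with
  | justWoken =>
    rw [advance_justWoken, advance_justWoken]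
    split_ifs with h1 h2
    · exact le_rfl
    · exact absurd (h1.mono h) h2
    · exact Nat.zero_le _
    · exact le_rfl
  | movingDown =>
    rw [advance_movingDown, advance_movingDown]
    split_ifs with h1 h2
    · exact le_rfl
    · exact absurd (h1.imp_right (Pointed.mono h)) h2
    · exact Nat.zero_le _
    · exact le_rfl
  | cameUp c =>
    rcases eq_or_ne v [] with rfl | hv
    · exact le_rfl
    · rw [advance_cameUp hv, advance_cameUp hv]
      exact ups_mono _ (h _)

/-- The state `u` has executed exactly the instructions in `a`. -/
structure Executed (N : Vertex d → ℕ) (η : Stack d) (a : Vertex d → Mode d → ℕ)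
    (u : TokenState d) : Prop where
  used : ∀ v s, u.used v s = a v s
  pending : ∀ v s, u.used v s + u.pending v s = advance N η a v s
  visited : ∀ w, w ∈ u.visited ↔ w = [] ∨ Pointed η a w

theorem Executed.ups_advance {a : Vertex d → Mode d → ℕ} {u : TokenState d}
    (h : Executed N η a u) (v : Vertex d) :
    ups (η.instr v) (advance N η a v) = ups (η.instr v) (a v) + u.upMoves η v := by
  rw [ups, ups, TokenState.upMoves, ← Finset.sum_add_distrib]
  refine Finset.sum_congr rfl fun s _ => ?_
  rw [← h.pending, ← h.used, ← Nat.count_eq_card_filter_range, ← Nat.count_eq_card_filter_range,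
    ← Nat.count_eq_card_filter_range, Nat.count_add]

theorem Executed.pointed_advance {a : Vertex d → Mode d → ℕ} {u : TokenState d}
    (h : Executed N η a u) (w : Vertex d) :
    Pointed η (advance N η a) w ↔ Pointed η a w ∨ u.Reaches η w := by
  constructor
  · rintro ⟨v, s, i, j, hi, hj, rfl⟩
    rcases lt_or_ge i (a v s) with hlt | hge
    · exact Or.inl ⟨v, s, i, j, hlt, hj, rfl⟩
    · refine Or.inr ⟨v, s, i - a v s, j, ?_, ?_, rfl⟩
      · rw [← h.pending, h.used] at hi
        omega
      · rwa [h.used, Nat.add_sub_cancel' hge]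
  · rintro (hp | ⟨v, s, i, j, hi, hj, rfl⟩)
    · exact hp.mono fun v s => by rw [← h.pending, h.used]; exact Nat.le_add_right _ _
    · exact ⟨v, s, u.used v s + i, j, by rw [← h.pending]; omega, hj, rfl⟩

/-- Recasts the dynamics as iteration of the monotone map `advance`: it recomputes the total
available instructions from the executed ones, instead of adding increments. -/
theorem Executed.next {a : Vertex d → Mode d → ℕ} {u : TokenState d} (h : Executed N η a u) :
    Executed N η (advance N η a) (u.next N η) where
  used v s := h.pending v s
  visited w := by
    rw [h.pointed_advance, ← or_assoc, ← h.visited]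
    rfl
  pending v s := by
    classical
    have hu : (u.next N η).used v s = advance N η a v s := h.pending v s
    rw [hu]
    cases s with
    | justWoken =>
      simp only [TokenState.next, advance_justWoken, h.pointed_advance, h.visited]
      rcases eq_or_ne v [] with rfl | hv
      · have : ¬ u.Reaches η [] := by
          rintro ⟨_, _, _, _, _, _, h⟩
          cases h
        simp [not_pointed_nil, this]
      · by_cases h1 : Pointed η a v <;> by_cases h2 : u.Reaches η v <;> simp [h1, h2, hv]
    | movingDown =>
      simp only [TokenState.next, advance_movingDown, h.pointed_advance, h.visited]
      by_cases hv : v = [] <;> by_cases h1 : Pointed η a v <;> by_cases h2 : u.Reaches η v <;>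
        simp [h1, h2, hv]
    | cameUp c =>
      cases v with
      | nil => rfl
      | cons b w =>
        rw [advance_cameUp (by simp), advance_cameUp (by simp), h.ups_advance]
        rfl

theorem Executed.exits (k : ℕ) : ∀ {a : Vertex d → Mode d → ℕ} {u : TokenState d},
    Executed N η a u → ∑ j : Fin d, ups (η.instr [j]) (a [j]) + u.exits N η k =
      ∑ j : Fin d, ups (η.instr [j]) ((advance N η)^[k] a [j]) := by
  induction k with
  | zero => intro a u _; rfl
  | succ k ih =>
    intro a u h
    rw [Function.iterate_succ_apply, ← ih h.next, TokenState.exits, ← add_assoc,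
      ← Finset.sum_add_distrib]
    simp only [h.ups_advance]

theorem executed_init : Executed N η (fun _ _ => 0) (TokenState.init d) where
  used _ _ := rfl
  pending v s := by
    classical
    have hp : ∀ w, ¬ Pointed η (fun _ _ => 0) w := by
      rintro w ⟨v, s, i, j, hi, _⟩
      exact absurd hi (Nat.not_lt_zero _)
    cases s with
    | justWoken => simp [advance_justWoken, hp, TokenState.init]
    | movingDown =>
      rw [advance_movingDown]
      cases v <;> simp [hp, TokenState.init]
    | cameUp c =>
      cases v with
      | nil => rfl
      | cons b w =>
        rw [advance_cameUp (by simp)]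
        simp [ups, TokenState.init]
  visited w := by
    have : ¬ Pointed η (fun _ _ => 0) w := by
      rintro ⟨v, s, i, j, hi, _⟩
      exact absurd hi (Nat.not_lt_zero _)
    simp [TokenState.init, this]

variable (N η) in
/-- The instructions that are executed or pending after `T` steps. -/
noncomputable def availAt (T : ℕ) : Vertex d → Mode d → ℕ := (advance N η)^[T] fun _ _ => 0

theorem availAt_succ (T : ℕ) : availAt N η (T + 1) = advance N η (availAt N η T) :=
  Function.iterate_succ_apply' _ _ _

theorem availAt_le_succ (T : ℕ) (v : Vertex d) (s : Mode d) :
    availAt N η T v s ≤ availAt N η (T + 1) v s := by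
  induction T generalizing v s with
  | zero => exact Nat.zero_le _
  | succ T ih =>
    rw [availAt_succ, availAt_succ]
    exact advance_mono ih v s

theorem availAt_mono {T T' : ℕ} (h : T ≤ T') (v : Vertex d) (s : Mode d) :
    availAt N η T v s ≤ availAt N η T' v s :=
  monotone_nat_of_le_succ (f := fun T => availAt N η T v s) (fun T => availAt_le_succ T v s) h

theorem exits_init (T : ℕ) : (TokenState.init d).exits N η T =
    ∑ j : Fin d, ups (η.instr [j]) (availAt N η T [j]) := by
  rw [availAt, ← executed_init.exits T]
  simp [ups]

theorem exists_ne_zero_of_ups {ζ : Mode d × ℕ → Move d} {a : Mode d → ℕ} (h : ups ζ a ≠ 0) :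
    ∃ s, a s ≠ 0 := by
  by_contra! hn
  exact h (by simp [ups, hn])

/-- The substantial case is a frog that returns from `c :: w`: that vertex must have been pointed
to, which is possible only from `w`, so `w` already had available instructions. -/
theorem pointed_of_availAt_ne_zero (T : ℕ) : ∀ (w : Vertex d) (s : Mode d),
    availAt N η T w s ≠ 0 → w = [] ∨ Pointed η (availAt N η T) w := by
  classical
  induction T with
  | zero => intro w s h; exact absurd rfl h
  | succ T ih =>
    intro w s h
    have hmono : ∀ w, Pointed η (availAt N η T) w → Pointed η (availAt N η (T + 1)) w :=
      fun w => Pointed.mono (availAt_le_succ T)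
    rw [availAt_succ] at h
    cases s with
    | justWoken =>
      rw [advance_justWoken] at h
      by_cases hp : Pointed η (availAt N η T) w
      · exact Or.inr (hmono w hp)
      · simp [hp] at h
    | movingDown =>
      rw [advance_movingDown] at h
      by_cases hp : w = [] ∨ Pointed η (availAt N η T) w
      · exact hp.imp_right (hmono w)
      · simp [hp] at h
    | cameUp c =>
      rcases eq_or_ne w [] with hw | hw
      · exact Or.inl hw
      · rw [advance_cameUp hw] at h
        obtain ⟨s, hs⟩ := exists_ne_zero_of_ups h
        rcases ih _ s hs with hc | ⟨v, s', i, j, hi, _, hv⟩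
        · cases hc
        · cases hv
          exact (ih w s' (by omega)).imp_right (hmono w)

theorem subtreeExits_le_succ (n : ℕ) : ∀ v : Vertex d,
    subtreeExits N η n v ≤ subtreeExits N η (n + 1) v := by
  induction n with
  | zero => exact fun _ => Nat.zero_le _
  | succ n ih => exact fun v => localExits_mono _ _ fun c => ih _

/-- Upper bound on the simultaneous dynamics. After `T` steps nothing deeper than `T` levels can
matter. A frog returns from `c` only if an instruction at `v` pointed to `c`, which forces `c ∈ K`;
the number of such frogs is bounded by applying the induction hypothesis at `c :: v` with its own
least closed set. -/
theorem availAt_le_avail (T : ℕ) : ∀ v : Vertex d, v ≠ [] → ∀ K : Finset (Fin d),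
    IsClosedUnder (η.instr v) (avail (N v) (fun c => subtreeExits N η T (c :: v)) K) K →
    ∀ s, availAt N η T v s ≤ avail (N v) (fun c => subtreeExits N η T (c :: v)) K s := by
  classical
  induction T with
  | zero => exact fun _ _ _ _ _ => Nat.zero_le _
  | succ T ih =>
    intro v hv K hK s
    have hK' : IsClosedUnder (η.instr v) (avail (N v) (fun c => subtreeExits N η T (c :: v)) K) K :=
      hK.anti (avail_mono (fun c => subtreeExits_le_succ T _) subset_rfl)
    rw [availAt_succ]
    cases s with
    | justWoken =>
      rw [advance_justWoken]
      simp only [avail]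
      split_ifs <;> simp
    | movingDown =>
      rw [advance_movingDown]
      simp only [avail]
      split_ifs <;> simp
    | cameUp c =>
      rw [advance_cameUp hv]
      by_cases h0 : ups (η.instr (c :: v)) (availAt N η T (c :: v)) = 0
      · rw [h0]; exact Nat.zero_le _
      · obtain ⟨s, hs⟩ := exists_ne_zero_of_ups h0
        have hc : c ∈ K := by
          rcases pointed_of_availAt_ne_zero T _ s hs with h | ⟨v', s', i, j, hi, hj, h⟩
          · cases h
          · cases h
            exact hK' s' i c (hi.trans_le (ih v hv K hK' s')) hj
        obtain ⟨K₁, h1, h2, _⟩ := localExits_spec (η.instr (c :: v)) (N (c :: v))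
          fun c' => subtreeExits N η T (c' :: c :: v)
        simp only [avail, hc, if_true]
        rw [subtreeExits, h2]
        exact ups_mono _ (ih _ (by simp) K₁ h1)

theorem ups_availAt_le (T : ℕ) {v : Vertex d} (hv : v ≠ []) :
    ups (η.instr v) (availAt N η T v) ≤ subtreeExits N η (T + 1) v := by
  obtain ⟨K, h1, h2, _⟩ := localExits_spec (η.instr v) (N v) fun c => subtreeExits N η T (c :: v)
  rw [subtreeExits, h2]
  exact ups_mono _ (availAt_le_avail T v hv K h1)

/-- Conversely, the simultaneous dynamics eventually execute everything that the depth-`n`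
exploration does. -/
theorem exists_subtreeExits_le (n : ℕ) : ∀ v : Vertex d, v ≠ [] →
    (∃ T, Pointed η (availAt N η T) v) →
    ∃ T, subtreeExits N η n v ≤ ups (η.instr v) (availAt N η T v) := by
  classical
  induction n with
  | zero => exact fun _ _ _ => ⟨0, Nat.zero_le _⟩
  | succ n ih =>
    rintro v hv ⟨T₀, hT₀⟩
    -- The children of `v` that are ever visited. There are finitely many modes, so one time serves
    -- them all; then `K'` is closed and contains the least closed set.
    let K' : Finset (Fin d) := Finset.univ.filter fun c => ∃ T, Pointed η (availAt N η T) (c :: v)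
    have h1 : ∀ s, ∃ T, avail (N v) (fun c => subtreeExits N η n (c :: v)) K' s ≤
        availAt N η T v s := by
      intro s
      cases s with
      | justWoken => exact ⟨T₀ + 1, by rw [availAt_succ, advance_justWoken, if_pos hT₀]; rfl⟩
      | movingDown =>
        exact ⟨T₀ + 1, by rw [availAt_succ, advance_movingDown, if_pos (Or.inr hT₀)]; rfl⟩
      | cameUp c =>
        by_cases hc : c ∈ K'
        · obtain ⟨T, hT⟩ := ih (c :: v) (by simp) (Finset.mem_filter.1 hc).2
          refine ⟨T + 1, ?_⟩
          rw [availAt_succ, advance_cameUp hv]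
          simpa [avail, hc] using hT
        · exact ⟨0, by simp [avail, hc]⟩
    choose T hT using h1
    have h2 : ∀ s, avail (N v) (fun c => subtreeExits N η n (c :: v)) K' s ≤
        availAt N η (Finset.univ.sup T) v s :=
      fun s => (hT s).trans (availAt_mono (Finset.le_sup (Finset.mem_univ s)) v s)
    have hK' : IsClosedUnder (η.instr v) (avail (N v) (fun c => subtreeExits N η n (c :: v)) K') K' :=
      fun s i c hi hc => Finset.mem_filter.2
        ⟨Finset.mem_univ _, _, v, s, i, c, hi.trans_le (h2 s), hc, rfl⟩
    obtain ⟨K, _, g2, g3⟩ := localExits_spec (η.instr v) (N v) fun c => subtreeExits N η n (c :: v)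
    refine ⟨Finset.univ.sup T, ?_⟩
    rw [subtreeExits, g2]
    exact ups_mono _ fun s => (avail_mono (fun _ => le_rfl) (g3 K' hK') s).trans (h2 s)

/-- Frogs reaching the root are killed, so the root only ever executes the first jump of the initial
frog. -/
theorem availAt_nil (T : ℕ) (s : Mode d) :
    availAt N η T [] s ≤ if s = .movingDown then 1 else 0 := by
  classical
  cases T with
  | zero => exact Nat.zero_le _
  | succ T =>
    rw [availAt_succ]
    cases s with
    | justWoken => simp [advance_justWoken, not_pointed_nil]
    | movingDown => simp [advance_movingDown]
    | cameUp c => simp [advance_cameUp_nil]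

/-- The jumps to the root all come from the subtree that the initial frog enters. -/
theorem exists_le_exits_iff {m : ℕ} (hm : m ≠ 0) :
    (∃ T, m ≤ (TokenState.init d).exits N η T) ↔
      ∃ j n, η ([], .movingDown, 0) = .toChild j ∧ m ≤ subtreeExits N η n [j] := by
  classical
  constructor
  · rintro ⟨T, hT⟩
    rw [exits_init] at hT
    have hj : ∀ j : Fin d, ups (η.instr [j]) (availAt N η T [j]) ≠ 0 →
        η ([], .movingDown, 0) = .toChild j := by
      intro j h
      obtain ⟨s, hs⟩ := exists_ne_zero_of_ups h
      rcases pointed_of_availAt_ne_zero T _ s hs with h | ⟨v, s', i, j', hi, hj, h⟩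
      · cases h
      · cases h
        have := hi.trans_le (availAt_nil T s')
        split_ifs at this with hs'
        · subst hs'
          obtain rfl : i = 0 := by omega
          exact hj
        · omega
    obtain ⟨j, _, h⟩ := Finset.exists_ne_zero_of_sum_ne_zero (by omega :
      ∑ j : Fin d, ups (η.instr [j]) (availAt N η T [j]) ≠ 0)
    refine ⟨j, T + 1, hj j h, hT.trans ?_⟩
    rw [Finset.sum_eq_single j]
    · exact ups_availAt_le T (by simp)
    · intro j' _ hne
      by_contra h'
      have := (hj j h).symm.trans (hj j' h')
      simp only [Move.toChild.injEq] at this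
      exact hne this.symm
    · simp
  · rintro ⟨j, n, hj, hn⟩
    obtain ⟨T, hT⟩ := exists_subtreeExits_le (N := N) (η := η) n [j] (by simp)
      ⟨1, [], .movingDown, 0, j, by simp [availAt, advance_movingDown], hj, rfl⟩
    refine ⟨T, ?_⟩
    rw [exits_init]
    exact hn.trans (hT.trans (Finset.single_le_sum
      (f := fun j : Fin d => ups (η.instr [j]) (availAt N η T [j])) (fun _ _ => Nat.zero_le _)
      (Finset.mem_univ j)))

end Availability

/-- Integrals of monotone functions are monotone in the stochastic order. -/
theorem lintegral_le_of_tail_le {π π' : Measure ℕ} [IsProbabilityMeasure π]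
    [IsProbabilityMeasure π'] (h : ∀ m : ℕ, π {n | m ≤ n} ≤ π' {n | m ≤ n}) {f : ℕ → ENNReal}
    (hf : Monotone f) : ∫⁻ n, f n ∂π ≤ ∫⁻ n, f n ∂π' := by
  -- Layer-cake decomposition: `f` is a constant plus nonnegative multiples of indicators of tails.
  have hfs : ∀ n, f n = f 0 + ∑' i, {n | i + 1 ≤ n}.indicator (fun _ => f (i + 1) - f i) n := by
    intro n
    rw [tsum_eq_sum (s := Finset.range n)]
    · induction n with
      | zero => simp
      | succ n ih =>
        have h1 : ∀ i ∈ Finset.range n, {m | i + 1 ≤ m}.indicator (fun _ => f (i + 1) - f i) (n + 1)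
            = {m | i + 1 ≤ m}.indicator (fun _ => f (i + 1) - f i) n := by
          intro i hi
          have := Finset.mem_range.1 hi
          rw [Set.indicator_of_mem, Set.indicator_of_mem]
          · exact this
          · exact Nat.le_succ_of_le this
        rw [Finset.sum_range_succ, Finset.sum_congr rfl h1, ← add_assoc, ← ih,
          Set.indicator_of_mem (show n + 1 ∈ {m : ℕ | n + 1 ≤ m} from le_refl (n + 1)), add_tsub_cancel_of_le (hf (Nat.le_succ n))]
    · intro i hi
      refine Set.indicator_of_notMem (fun hn => hi (Finset.mem_range.2 ?_)) _
      exact hn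
  have hint : ∀ (ρ : Measure ℕ) [IsProbabilityMeasure ρ],
      ∫⁻ n, f n ∂ρ = f 0 + ∑' i, (f (i + 1) - f i) * ρ {n | i + 1 ≤ n} := by
    intro ρ _
    rw [lintegral_congr hfs, lintegral_add_left measurable_const, lintegral_const, measure_univ,
      mul_one, lintegral_tsum fun i => (Measurable.of_discrete).aemeasurable]
    congr 1
    refine tsum_congr fun i => ?_
    rw [lintegral_indicator (MeasurableSet.of_discrete), setLIntegral_const]
  rw [hint π, hint π']
  exact add_le_add le_rfl (ENNReal.tsum_le_tsum fun i => mul_le_mul_right (h (i + 1)) _)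

/-! ### The local Markov recursion and its monotonicity -/

section Chain

variable (up σ : Bool → ENNReal) (π : Measure ℕ)

/-- One step of `chain`: the first pending frog leaves to the parent with probability `up a`, and
enters each of the `g` unvisited children with probability `σ a`. -/
noncomputable def chainStep (g : ℕ) (next : List Bool → ℕ → ENNReal) : List Bool → ℕ → ENNReal
  | [], q => if q = 0 then 1 else 0
  | a :: L, q => up a * chainStep g next L (q - 1) + (1 - (up a + g * σ a)) * chainStep g next L q
      + g * σ a * ∫⁻ n, next (L ++ List.replicate n false) q ∂π

/-- The probability that at least `q` frogs leave a vertex to its parent, when `g` of its children are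
unvisited and the frogs in the list are pending (`true` for frogs just woken, `false` for frogs that
returned from a child), if the number of frogs returning from a child has law `π`. -/
noncomputable def chain : ℕ → List Bool → ℕ → ENNReal
  | 0 => chainStep up σ π 0 fun _ _ => 0
  | g + 1 => chainStep up σ π (g + 1) (chain g)

/-- The continuation of `chain` after a frog has entered an unvisited child. -/
noncomputable def chainNext : ℕ → List Bool → ℕ → ENNReal
  | 0, _, _ => 0
  | g + 1, L, q => ∫⁻ n, chain up σ π g (L ++ List.replicate n false) q ∂π

variable {up σ π}

theorem chain_nil (g q : ℕ) : chain up σ π g [] q = if q = 0 then 1 else 0 := by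
  cases g <;> rfl

theorem chain_cons (g : ℕ) (a : Bool) (L : List Bool) (q : ℕ) :
    chain up σ π g (a :: L) q = up a * chain up σ π g L (q - 1) +
      (1 - (up a + g * σ a)) * chain up σ π g L q + g * σ a * chainNext up σ π g L q := by
  cases g with
  | zero => simp [chain, chainStep]
  | succ g => rfl

theorem chain_antitone (g : ℕ) (L : List Bool) : Antitone (chain up σ π g L) := by
  induction g generalizing L with
  | zero =>
    induction L with
    | nil =>
      intro q q' h
      rw [chain_nil, chain_nil]
      split_ifs with h1 h2
      · exact le_rfl
      · omega
      · exact zero_le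
      · exact le_rfl
    | cons a L ih =>
      intro q q' h
      rw [chain_cons, chain_cons]
      have h1 := ih h
      have h2 := ih (Nat.sub_le_sub_right h 1)
      simp only [Nat.cast_zero, zero_mul]
      gcongr
  | succ g ihg =>
    induction L with
    | nil =>
      intro q q' h
      rw [chain_nil, chain_nil]
      split_ifs with h1 h2
      · exact le_rfl
      · omega
      · exact zero_le
      · exact le_rfl
    | cons a L ih =>
      intro q q' h
      rw [chain_cons, chain_cons]
      have h1 := ih h
      have h2 := ih (Nat.sub_le_sub_right h 1)
      have h3 : chainNext up σ π (g + 1) L q' ≤ chainNext up σ π (g + 1) L q :=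
        lintegral_mono fun n => ihg _ h
      gcongr

theorem one_sub_add_add {u v : ENNReal} (h : u + v ≤ 1) : 1 - (u + v) + v = 1 - u := by
  rw [← tsub_tsub]
  exact tsub_add_cancel_of_le (ENNReal.le_sub_of_add_le_left (ne_top_of_le_ne_top ENNReal.one_ne_top
    (le_self_add.trans h)) h)

variable {G : ℕ}

theorem coeff_le (hG : ∀ a, up a + G * σ a ≤ 1) {g : ℕ} (hg : g ≤ G) (a : Bool) :
    up a + g * σ a ≤ 1 := by
  refine le_trans ?_ (hG a)
  gcongr

theorem chain_zero [IsProbabilityMeasure π] (hG : ∀ a, up a + G * σ a ≤ 1) (g : ℕ) (hg : g ≤ G)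
    (L : List Bool) : chain up σ π g L 0 = 1 := by
  induction g generalizing L with
  | zero =>
    induction L with
    | nil => simp [chain_nil]
    | cons a L ih =>
      have := coeff_le hG hg a
      rw [chain_cons, ih]
      simp only [Nat.cast_zero, zero_mul, add_zero, mul_one] at this ⊢
      exact add_tsub_cancel_of_le this
  | succ g ihg =>
    induction L with
    | nil => simp [chain_nil]
    | cons a L ih =>
      have h1 : chainNext up σ π (g + 1) L 0 = 1 := by
        simp [chainNext, ihg (by omega)]
      rw [chain_cons, ih, h1, mul_one, mul_one, mul_one, add_right_comm]
      exact add_tsub_cancel_of_le (coeff_le hG hg a)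

/-- Treating the opening of a new child as a death only loses exits. That opening helps is taken as
the hypothesis `hnext`, because this lemma is used inside the induction that proves it. -/
theorem chain_cons_ge (hG : ∀ a, up a + G * σ a ≤ 1) {g : ℕ} (hg : g ≤ G)
    (hnext : g ≠ 0 → ∀ L q, chain up σ π g L q ≤ chainNext up σ π g L q) (a : Bool) (L : List Bool)
    (q : ℕ) :
    up a * chain up σ π g L (q - 1) + (1 - up a) * chain up σ π g L q ≤
      chain up σ π g (a :: L) q := by
  rw [chain_cons, ← one_sub_add_add (coeff_le hG hg a), add_mul, ← add_assoc]
  rcases eq_or_ne g 0 with rfl | h0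
  · simp
  · have := hnext h0 L q
    gcongr

/-- Visiting one more child does not decrease the number of frogs that leave. -/
theorem chain_le_chainNext [IsProbabilityMeasure π] (hG : ∀ a, up a + G * σ a ≤ 1) (g : ℕ)
    (hg : g ≤ G) (h0 : g ≠ 0) (L : List Bool) (q : ℕ) :
    chain up σ π g L q ≤ chainNext up σ π g L q := by
  induction g generalizing L q with
  | zero => exact absurd rfl h0
  | succ g ihg =>
    induction L generalizing q with
    | nil =>
      rw [chain_nil]
      split_ifs with hq
      · subst hq
        simp [chainNext, chain_zero hG g (by omega)]
      · exact zero_le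
    | cons a L ih =>
      -- If the head frog does not leave, both its possible fates are bounded by the situation with
      -- an extra open child. Conditionally on the number of frogs that child sends back,
      -- `chain_cons_ge` with one unvisited child fewer restores the head frog.
      have h1 : chain up σ π (g + 1) (a :: L) q ≤
          up a * chainNext up σ π (g + 1) L (q - 1) + (1 - up a) * chainNext up σ π (g + 1) L q := by
        rw [chain_cons, ← one_sub_add_add (coeff_le hG hg a), add_mul, ← add_assoc]
        have := ih q
        have := ih (q - 1)
        gcongr
      refine h1.trans ?_
      simp only [chainNext]
      rw [← lintegral_const_mul _ Measurable.of_discrete,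
        ← lintegral_const_mul _ Measurable.of_discrete,
        ← lintegral_add_left Measurable.of_discrete]
      refine lintegral_mono fun n => ?_
      exact chain_cons_ge hG (by omega) (fun h L q => ihg (by omega) h L q) a _ q

/-- An additional pending frog does not decrease the number of frogs that leave. -/
theorem chain_le_insert [IsProbabilityMeasure π] (hG : ∀ a, up a + G * σ a ≤ 1) (g : ℕ)
    (hg : g ≤ G) (L L' : List Bool) (b : Bool) (q : ℕ) :
    chain up σ π g (L ++ L') q ≤ chain up σ π g (L ++ b :: L') q := by
  induction g generalizing L L' q with
  | zero =>
    induction L generalizing q with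
    | nil =>
      -- At worst the inserted frog dies without effect; if it leaves, only `q - 1` further exits
      -- are needed.
      refine le_trans ?_ (chain_cons_ge hG hg (fun h => absurd rfl h) b L' q)
      have h1 : chain up σ π 0 L' q ≤ chain up σ π 0 L' (q - 1) :=
        chain_antitone 0 L' (Nat.sub_le q 1)
      have h2 : up b ≤ 1 := le_self_add.trans (hG b)
      calc chain up σ π 0 L' q = (up b + (1 - up b)) * chain up σ π 0 L' q := by
            rw [add_tsub_cancel_of_le h2, one_mul]
        _ ≤ _ := by rw [add_mul]; gcongr
    | cons a L ih =>
      rw [List.cons_append, List.cons_append, chain_cons, chain_cons]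
      have h1 := ih q
      have h2 := ih (q - 1)
      simp only [Nat.cast_zero, zero_mul]
      gcongr
  | succ g ihg =>
    induction L generalizing q with
    | nil =>
      refine le_trans ?_ (chain_cons_ge hG hg
        (fun h L q => chain_le_chainNext hG (g + 1) hg h L q) b L' q)
      have h1 : chain up σ π (g + 1) L' q ≤ chain up σ π (g + 1) L' (q - 1) :=
        chain_antitone _ L' (Nat.sub_le q 1)
      have h2 : up b ≤ 1 := le_self_add.trans (hG b)
      calc chain up σ π (g + 1) L' q = (up b + (1 - up b)) * chain up σ π (g + 1) L' q := by
            rw [add_tsub_cancel_of_le h2, one_mul]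
        _ ≤ _ := by rw [add_mul]; gcongr
    | cons a L ih =>
      rw [List.cons_append, List.cons_append, chain_cons, chain_cons]
      have h1 := ih q
      have h2 := ih (q - 1)
      have h3 : chainNext up σ π (g + 1) (L ++ L') q ≤
          chainNext up σ π (g + 1) (L ++ b :: L') q := by
        refine lintegral_mono fun n => ?_
        have := ihg (by omega) L (L' ++ List.replicate n false) q
        simpa [List.append_assoc] using this
      gcongr

theorem chain_replicate_mono [IsProbabilityMeasure π] (hG : ∀ a, up a + G * σ a ≤ 1) {g : ℕ}
    (hg : g ≤ G) (L : List Bool) (q : ℕ) :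
    Monotone fun n => chain up σ π g (L ++ List.replicate n false) q :=
  monotone_nat_of_le_succ fun n => by
    rw [List.replicate_succ]
    exact chain_le_insert hG g hg L _ false q

/-- Mass is moved from the outcome `y` (death) to the outcomes `x` (exit) and `z` (new child), which
are at least as good. -/
theorem convex_le {u v u' v' x y z : ENNReal} (hu : u ≤ u') (hv : v ≤ v') (h1 : u' + v' ≤ 1)
    (hx : y ≤ x) (hz : y ≤ z) :
    u * x + (1 - (u + v)) * y + v * z ≤ u' * x + (1 - (u' + v')) * y + v' * z := by
  obtain ⟨a, rfl⟩ := exists_add_of_le hu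
  obtain ⟨b, rfl⟩ := exists_add_of_le hv
  have h2 : u + v + (a + b) ≤ 1 := by
    rw [add_add_add_comm]
    exact h1
  rw [add_add_add_comm u a v b, ← one_sub_add_add h2]
  calc u * x + (1 - (u + v + (a + b)) + (a + b)) * y + v * z
      = u * x + (1 - (u + v + (a + b))) * y + v * z + a * y + b * y := by ring
    _ ≤ u * x + (1 - (u + v + (a + b))) * y + v * z + a * x + b * z := by gcongr
    _ = _ := by ring

variable {up' σ' : Bool → ENNReal} {π' : Measure ℕ}

/-- Monotonicity of `chain` in its parameters. -/
theorem chain_le_chain [IsProbabilityMeasure π] [IsProbabilityMeasure π']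
    (hG' : ∀ a, up' a + (G + 1 : ℕ) * σ' a ≤ 1)
    (hup : ∀ a, up a ≤ up' a) (hσ : ∀ a, ∀ g ≤ G, (g : ENNReal) * σ a ≤ (g + 1 : ℕ) * σ' a)
    (hπ : ∀ m : ℕ, π {n | m ≤ n} ≤ π' {n | m ≤ n}) (g : ℕ) (hg : g ≤ G) (L : List Bool) (q : ℕ) :
    chain up σ π g L q ≤ chain up' σ' π' (g + 1) L q := by
  induction g generalizing L q with
  | zero =>
    induction L generalizing q with
    | nil => rw [chain_nil, chain_nil]
    | cons a L ih =>
      rw [chain_cons, chain_cons]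
      -- The values are compared first, with the weights unchanged; then the weights are replaced,
      -- using the order of the outcomes in the larger model.
      refine le_trans ?_ (convex_le (hup a) (hσ a 0 hg) (coeff_le hG' (by omega) a)
        (chain_antitone _ L (Nat.sub_le q 1))
        (chain_le_chainNext hG' 1 (by omega) (by omega) L q))
      have h1 := ih q
      have h2 := ih (q - 1)
      simp only [Nat.cast_zero, zero_mul]
      gcongr
  | succ g ihg =>
    induction L generalizing q with
    | nil => rw [chain_nil, chain_nil]
    | cons a L ih =>
      rw [chain_cons, chain_cons]
      refine le_trans ?_ (convex_le (hup a) (hσ a (g + 1) hg) (coeff_le hG' (by omega) a)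
        (chain_antitone _ L (Nat.sub_le q 1))
        (chain_le_chainNext hG' (g + 1 + 1) (by omega) (by omega) L q))
      have h1 := ih q
      have h2 := ih (q - 1)
      have h3 : chainNext up σ π (g + 1) L q ≤ chainNext up' σ' π' (g + 1 + 1) L q :=
        (lintegral_mono fun n => ihg (by omega) _ q).trans
          (lintegral_le_of_tail_le hπ (chain_replicate_mono hG' (by omega) L q))
      gcongr

end Chain

/-! ### The law of the local exploration is given by `chain` -/

section ExploreLaw

variable {d : ℕ}

theorem measurable_comp_countable {α β γ : Type*} [MeasurableSpace α] [MeasurableSpace β]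
    [MeasurableSpace γ] [Countable β] [MeasurableSingletonClass β] {g : α → β} {F : β → α → γ}
    (hg : Measurable g) (hF : ∀ b, Measurable (F b)) : Measurable fun a => F (g a) a :=
  (measurable_from_prod_countable_right (f := fun x : β × α => F x.1 x.2) hF).comp
    (hg.prodMk measurable_id)

/-- The value of `explore` after the first instruction has been read. -/
def exploreAfter (ζ : Mode d × ℕ → Move d) (w : Fin d → ℕ) (K : Finset (Fin d))
    (L : List (Mode d × ℕ)) : Move d → ℕ
  | .toParent => explore ζ w K L + 1
  | .toChild c => if c ∈ K then explore ζ w K L else explore ζ w (insert c K) (L ++ returns c (w c))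

theorem explore_cons (ζ : Mode d × ℕ → Move d) (w : Fin d → ℕ) (K : Finset (Fin d))
    (τ : Mode d × ℕ) (L : List (Mode d × ℕ)) :
    explore ζ w K (τ :: L) = exploreAfter ζ w K L (ζ τ) := by
  rw [explore]
  cases ζ τ <;> simp [exploreAfter]

theorem measurable_explore (w : Fin d → ℕ) (K : Finset (Fin d)) (L : List (Mode d × ℕ)) :
    Measurable fun ζ : Mode d × ℕ → Move d => explore ζ w K L := by
  revert K L
  refine explore_induction (fun K => ?_) fun K τ L ih1 ih2 => ?_
  · simp only [explore]
    exact measurable_const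
  · simp only [explore_cons]
    refine measurable_comp_countable (F := fun m ζ => exploreAfter ζ w K L m)
      (measurable_pi_apply τ) fun m => ?_
    cases m with
    | toParent => exact ih1.add_const 1
    | toChild c =>
      simp only [exploreAfter]
      split_ifs with hc
      · exact ih1
      · exact ih2 c hc _

/-- Locality: only the listed instructions and the data of children outside `K` can influence the
exploration. It supplies the independence needed for conditioning. -/
theorem explore_congr {ζ ζ' : Mode d × ℕ → Move d} {w w' : Fin d → ℕ} (K : Finset (Fin d))
    (L : List (Mode d × ℕ)) : (∀ τ ∈ L, ζ τ = ζ' τ) →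
      (∀ c ∉ K, w c = w' c ∧ ∀ j, ζ (.cameUp c, j) = ζ' (.cameUp c, j)) →
      explore ζ w K L = explore ζ' w' K L := by
  revert K L
  refine explore_induction (fun K => ?_) fun K τ L ih1 ih2 h1 h2 => ?_
  · simp [explore]
  · rw [explore_cons, explore_cons, h1 τ (by simp)]
    have e1 := ih1 (fun τ' h => h1 τ' (by simp [h])) h2
    cases ζ' τ with
    | toParent => simp only [exploreAfter, e1]
    | toChild c =>
      simp only [exploreAfter, e1]
      split_ifs with hc
      · rfl
      · rw [(h2 c hc).1]
        refine ih2 c hc _ (fun τ' h => ?_) fun c' hc' => h2 c' fun h =>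
          hc' (Finset.mem_insert_of_mem h)
        rcases List.mem_append.1 h with h | h
        · exact h1 τ' (by simp [h])
        · obtain ⟨j, _, rfl⟩ := mem_returns.1 h
          exact (h2 c hc).2 j

/-- The law of the instructions at a vertex. -/
noncomputable abbrev instrLaw (law : Mode d → PMF (Move d)) : Measure (Mode d × ℕ → Move d) :=
  Measure.infinitePi fun x => (law x.1).toMeasure

theorem sum_move {f : Move d → ENNReal} : ∑ m, f m = f .toParent + ∑ c, f (.toChild c) := by
  rw [← (moveEquiv d).sum_comp, Fintype.sum_option]
  rfl

/-- Conditions on the head instruction. By `hτ` and `hτK` it is neither in the rest of the list nor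
among the returns of a child still to be opened, so it is never read again. -/
theorem measure_explore_cons (law : Mode d → PMF (Move d)) (w : Fin d → ℕ) (K : Finset (Fin d))
    {τ : Mode d × ℕ} {L : List (Mode d × ℕ)} (hτ : τ ∉ L) (hτK : ∀ c, τ.1 = .cameUp c → c ∈ K)
    (q : ℕ) :
    instrLaw law {ζ | q ≤ explore ζ w K (τ :: L)} =
      law τ.1 .toParent * instrLaw law {ζ | q - 1 ≤ explore ζ w K L} +
      (∑ c ∈ K, law τ.1 (.toChild c)) * instrLaw law {ζ | q ≤ explore ζ w K L} +
      ∑ c ∈ Kᶜ, law τ.1 (.toChild c) *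
        instrLaw law {ζ | q ≤ explore ζ w (insert c K) (L ++ returns c (w c))} := by
  classical
  have hm : ∀ m, Measurable fun ζ : Mode d × ℕ → Move d => exploreAfter ζ w K L m := by
    intro m
    cases m with
    | toParent => exact (measurable_explore w K L).add_const 1
    | toChild c =>
      simp only [exploreAfter]
      split_ifs
      · exact measurable_explore w K L
      · exact measurable_explore w _ _
  have hE : ∀ m, MeasurableSet {ζ : Mode d × ℕ → Move d | q ≤ exploreAfter ζ w K L m} :=
    fun m => measurableSet_le measurable_const (hm m)
  have h1 : instrLaw law {ζ | q ≤ explore ζ w K (τ :: L)} = ∫⁻ ζ,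
      {ζ : Mode d × ℕ → Move d | q ≤ exploreAfter ζ w K L (ζ τ)}.indicator 1 ζ ∂instrLaw law := by
    rw [lintegral_indicator_one]
    · simp only [explore_cons]
    · simp only [← explore_cons]
      exact measurableSet_le measurable_const (measurable_explore w K _)
  have h2 := lintegral_infinitePi_coordinate (fun x : Mode d × ℕ => (law x.1).toMeasure) τ
    (fun m ζ => {ζ : Mode d × ℕ → Move d | q ≤ exploreAfter ζ w K L m}.indicator 1 ζ)
    (measurable_from_prod_countable_right fun m => measurable_one.indicator (hE m))
    (fun m y z hyz => by
      have : exploreAfter y w K L m = exploreAfter z w K L m := by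
        have hL : ∀ x ∈ L, y x = z x := fun x hx => hyz x fun h => hτ (h ▸ hx)
        have hK : ∀ c ∉ K, ∀ j, y (.cameUp c, j) = z (.cameUp c, j) := fun c hc j =>
          hyz _ fun h => hc (hτK c (h ▸ rfl))
        have e1 := explore_congr (w := w) (w' := w) K L hL fun c hc => ⟨rfl, hK c hc⟩
        cases m with
        | toParent => simp only [exploreAfter, e1]
        | toChild c =>
          simp only [exploreAfter, e1]
          split_ifs with hc
          · rfl
          · refine explore_congr _ _ (fun x hx => ?_) fun c' hc' => ⟨rfl, hK c' fun h =>
              hc' (Finset.mem_insert_of_mem h)⟩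
            rcases List.mem_append.1 hx with h | h
            · exact hL x h
            · obtain ⟨j, _, rfl⟩ := mem_returns.1 h
              exact hK c hc j
      simp only [Set.indicator_apply, Set.mem_ofPred_eq, this, Pi.one_apply])
  rw [h1]
  refine (lintegral_congr fun ζ => ?_).trans (h2.trans ?_)
  · simp only [Set.indicator_apply, Set.mem_ofPred_eq]
  rw [lintegral_fintype, sum_move]
  simp only [lintegral_indicator_one (hE _), PMF.toMeasure_apply_singleton _ _
    (MeasurableSet.of_discrete)]
  rw [add_assoc]
  congr 1
  · rw [mul_comm]
    congr 2
    ext ζ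
    simp only [exploreAfter, Set.mem_ofPred_eq]
    omega
  · rw [← Finset.sum_add_sum_compl K, Finset.sum_mul]
    congr 1
    · refine Finset.sum_congr rfl fun c hc => ?_
      simp only [exploreAfter, hc, if_true, mul_comm]
    · refine Finset.sum_congr rfl fun c hc => ?_
      simp only [exploreAfter, Finset.mem_compl.1 hc, if_false, mul_comm]

/-- Jumps from the modes `justWoken` (`true`) and `cameUp` (`false`) lead to the parent with
probability `up`, and to each admissible child with probability `σ`. -/
structure HasJumpProbs (law : Mode d → PMF (Move d)) (up σ : Bool → ENNReal) : Prop where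
  woken_up : law .justWoken .toParent = up true
  woken_child : ∀ c, law .justWoken (.toChild c) = σ true
  returned_up : ∀ c, law (.cameUp c) .toParent = up false
  returned_child : ∀ c c', c' ≠ c → law (.cameUp c) (.toChild c') = σ false
  down_child : ∀ c, law .movingDown (.toChild c) = (d : ENNReal)⁻¹

/-- Whether a frog has just been woken. -/
def Mode.isWoken : Mode d → Bool
  | .justWoken => true
  | _ => false

theorem sum_law (μ : PMF (Move d)) (K : Finset (Fin d)) :
    μ .toParent + ∑ c ∈ K, μ (.toChild c) + ∑ c ∈ Kᶜ, μ (.toChild c) = 1 := by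
  rw [add_assoc, Finset.sum_add_sum_compl, ← sum_move (f := fun m => μ m), ← μ.tsum_coe,
    tsum_fintype]

/-- The average of `explore` over the numbers of returning frogs is given by `chain`. -/
theorem lintegral_explore {law : Mode d → PMF (Move d)} {up σ : Bool → ENNReal}
    (hlaw : HasJumpProbs law up σ) (π : Measure ℕ) [IsProbabilityMeasure π] (K : Finset (Fin d))
    (L : List (Mode d × ℕ)) : L.Nodup → (∀ τ ∈ L, τ.1 ≠ .movingDown) →
      (∀ τ ∈ L, ∀ c, τ.1 = .cameUp c → c ∈ K) → ∀ q,
      ∫⁻ w, instrLaw law {ζ | q ≤ explore ζ w K L} ∂Measure.infinitePi (fun _ : Fin d => π) =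
        chain up σ π Kᶜ.card (L.map fun τ => τ.1.isWoken) q := by
  revert K L
  refine explore_induction (fun K => ?_) fun K τ L ih1 ih2 hnd hmd hcu q => ?_
  · intro _ _ _ q
    simp only [explore, List.map_nil, chain_nil, nonpos_iff_eq_zero]
    split_ifs with hq <;> simp [hq]
  · rw [List.nodup_cons] at hnd
    have e1 := fun q => ih1 hnd.2 (fun x hx => hmd x (by simp [hx]))
      (fun x hx => hcu x (by simp [hx])) q
    -- Once `c` is opened, `w c` enters only through the appended returns, so it can be integrated
    -- out separately under `π`.
    have e2 : ∀ c ∈ Kᶜ, ∫⁻ w, instrLaw law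
        {ζ | q ≤ explore ζ w (insert c K) (L ++ returns c (w c))}
          ∂Measure.infinitePi (fun _ : Fin d => π) =
        chainNext up σ π Kᶜ.card (L.map fun τ => τ.1.isWoken) q := by
      intro c hc
      have hcK := Finset.mem_compl.1 hc
      have hcard : Kᶜ.card = (insert c K)ᶜ.card + 1 := by
        rw [Finset.compl_insert, Finset.card_erase_add_one hc]
      rw [lintegral_infinitePi_coordinate (fun _ : Fin d => π) c
        (fun n w => instrLaw law {ζ | q ≤ explore ζ w (insert c K) (L ++ returns c n)})
        Measurable.of_discrete, hcard]
      · simp only [chainNext]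
        refine lintegral_congr fun n => ?_
        rw [ih2 c hcK]
        · simp only [List.map_append, returns, List.map_map]
          congr 2
          rw [List.eq_replicate_iff]
          simp [Mode.isWoken]
        · refine List.Nodup.append hnd.2 ?_ ?_
          · exact List.nodup_range.map fun i j h => (Prod.mk.inj h).2
          · intro x hx hx'
            obtain ⟨j, _, rfl⟩ := mem_returns.1 hx'
            exact hcK (hcu _ (List.mem_cons_of_mem _ hx) c rfl)
        · intro x hx
          rcases List.mem_append.1 hx with h | h
          · exact hmd x (by simp [h])
          · obtain ⟨j, _, rfl⟩ := mem_returns.1 h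
            simp
        · intro x hx c' hc'
          rcases List.mem_append.1 hx with h | h
          · exact Finset.mem_insert_of_mem (hcu x (by simp [h]) c' hc')
          · obtain ⟨j, _, rfl⟩ := mem_returns.1 h
            cases hc'
            exact Finset.mem_insert_self _ _
      · intro n y z hyz
        have : ∀ ζ : Mode d × ℕ → Move d, explore ζ y (insert c K) (L ++ returns c n) =
            explore ζ z (insert c K) (L ++ returns c n) := fun ζ =>
          explore_congr _ _ (fun _ _ => rfl) fun c' hc' =>
            ⟨hyz c' fun h => hc' (h ▸ Finset.mem_insert_self _ _), fun _ => rfl⟩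
        simp only [this]
    have hup : law τ.1 .toParent = up τ.1.isWoken ∧
        ∀ c ∈ Kᶜ, law τ.1 (.toChild c) = σ τ.1.isWoken := by
      obtain ⟨s, j⟩ := τ
      cases s with
      | justWoken => exact ⟨hlaw.woken_up, fun c _ => hlaw.woken_child c⟩
      | movingDown => exact absurd rfl (hmd _ List.mem_cons_self)
      | cameUp c =>
        refine ⟨hlaw.returned_up c, fun c' hc' => hlaw.returned_child c c' ?_⟩
        rintro rfl
        exact Finset.mem_compl.1 hc' (hcu _ List.mem_cons_self c' rfl)
    have hsum : ∑ c ∈ Kᶜ, law τ.1 (.toChild c) = Kᶜ.card * σ τ.1.isWoken := by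
      rw [Finset.sum_congr rfl hup.2, Finset.sum_const, nsmul_eq_mul]
    have htot := sum_law (law τ.1) K
    rw [hsum, hup.1] at htot
    -- Jumps to visited children are deaths. For a returned frog these include the child it came
    -- from, which lies in `K`; so all unvisited children have the same probability.
    have hdie : ∑ c ∈ K, law τ.1 (.toChild c) =
        1 - (up τ.1.isWoken + Kᶜ.card * σ τ.1.isWoken) := by
      refine ENNReal.eq_sub_of_add_eq ?_ ?_
      · refine ne_top_of_le_ne_top ENNReal.one_ne_top (le_of_le_of_eq ?_ htot)
        rw [add_right_comm]
        exact le_self_add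
      · rw [← htot]
        ring
    have hnew : ∫⁻ w, ∑ c ∈ Kᶜ, law τ.1 (.toChild c) * instrLaw law
        {ζ | q ≤ explore ζ w (insert c K) (L ++ returns c (w c))}
          ∂Measure.infinitePi (fun _ : Fin d => π) =
        Kᶜ.card * σ τ.1.isWoken * chainNext up σ π Kᶜ.card (L.map fun τ => τ.1.isWoken) q := by
      rw [lintegral_finsetSum _ fun _ _ => Measurable.of_discrete, ← hsum, Finset.sum_mul]
      refine Finset.sum_congr rfl fun c hc => ?_
      rw [lintegral_const_mul _ Measurable.of_discrete, e2 c hc]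
    have hτK : ∀ c, τ.1 = .cameUp c → c ∈ K := hcu τ (by simp)
    rw [lintegral_congr fun w => measure_explore_cons law w K hnd.1 hτK q,
      lintegral_add_left Measurable.of_discrete, lintegral_add_left Measurable.of_discrete,
      lintegral_const_mul _ Measurable.of_discrete, lintegral_const_mul _ Measurable.of_discrete,
      hnew, e1, e1, hdie, hup.1, List.map_cons, chain_cons]

/-- The first frog certainly opens a child, and by symmetry it does not matter which; hence
`chainNext` rather than `chain`. -/
theorem lintegral_localExits [NeZero d] {law : Mode d → PMF (Move d)} {up σ : Bool → ENNReal}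
    (hlaw : HasJumpProbs law up σ) (π : Measure ℕ) [IsProbabilityMeasure π] (n q : ℕ) :
    ∫⁻ w, instrLaw law {ζ | q ≤ localExits ζ n w} ∂Measure.infinitePi (fun _ : Fin d => π) =
      chainNext up σ π d (List.replicate n true) q := by
  have hd : (d : ENNReal) ≠ 0 := by exact_mod_cast NeZero.ne d
  have hsum : ∑ c : Fin d, law .movingDown (.toChild c) = 1 := by
    simp only [hlaw.down_child, Finset.sum_const, Finset.card_univ, Fintype.card_fin, nsmul_eq_mul]
    exact ENNReal.mul_inv_cancel hd (ENNReal.natCast_ne_top d)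
  have hup : law .movingDown .toParent = 0 := by
    have := sum_law (law .movingDown) ∅
    rw [Finset.compl_empty, hsum, Finset.sum_empty, add_zero] at this
    exact ENNReal.add_right_inj ENNReal.one_ne_top |>.1 (by rw [add_comm, this, add_zero])
  set L : List (Mode d × ℕ) := (List.range n).map fun i => (.justWoken, i) with hL
  have hmem : ∀ τ ∈ L, τ.1 = .justWoken := by
    intro τ hτ
    obtain ⟨i, _, rfl⟩ := List.mem_map.1 hτ
    rfl
  have hnd : L.Nodup := List.nodup_range.map fun i j h => (Prod.mk.inj h).2
  have e1 : ∀ c : Fin d, ∫⁻ w, instrLaw law {ζ | q ≤ explore ζ w {c} (L ++ returns c (w c))}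
      ∂Measure.infinitePi (fun _ : Fin d => π) = chainNext up σ π d (List.replicate n true) q := by
    intro c
    have hcard : d = ({c} : Finset (Fin d))ᶜ.card + 1 := by
      rw [Finset.card_compl, Fintype.card_fin, Finset.card_singleton]
      have := NeZero.pos d
      omega
    rw [lintegral_infinitePi_coordinate (fun _ : Fin d => π) c
      (fun n w => instrLaw law {ζ | q ≤ explore ζ w {c} (L ++ returns c n)})
      Measurable.of_discrete]
    · conv_rhs => rw [hcard]
      simp only [chainNext]
      refine lintegral_congr fun k => ?_
      rw [lintegral_explore hlaw]
      · simp only [List.map_append, returns, List.map_map, hL]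
        congr 2
        · rw [List.eq_replicate_iff]
          simp [Mode.isWoken]
        · rw [List.eq_replicate_iff]
          simp [Mode.isWoken]
      · refine List.Nodup.append hnd ?_ ?_
        · exact List.nodup_range.map fun i j h => (Prod.mk.inj h).2
        · intro x hx hx'
          obtain ⟨j, _, rfl⟩ := mem_returns.1 hx'
          cases hmem _ hx
      · intro x hx
        rcases List.mem_append.1 hx with h | h
        · simp [hmem x h]
        · obtain ⟨j, _, rfl⟩ := mem_returns.1 h
          simp
      · intro x hx c' hc'
        rcases List.mem_append.1 hx with h | h
        · rw [hmem x h] at hc'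
          cases hc'
        · obtain ⟨j, _, rfl⟩ := mem_returns.1 h
          cases hc'
          exact Finset.mem_singleton_self _
    · intro k y z hyz
      have : ∀ ζ : Mode d × ℕ → Move d, explore ζ y {c} (L ++ returns c k) =
          explore ζ z {c} (L ++ returns c k) := fun ζ =>
        explore_congr _ _ (fun _ _ => rfl) fun c' hc' =>
          ⟨hyz c' fun h => hc' (h ▸ Finset.mem_singleton_self _), fun _ => rfl⟩
      simp only [this]
  have h1 : ∀ w : Fin d → ℕ, instrLaw law {ζ | q ≤ localExits ζ n w} =
      ∑ c, law .movingDown (.toChild c) *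
        instrLaw law {ζ | q ≤ explore ζ w {c} (L ++ returns c (w c))} := by
    intro w
    have := measure_explore_cons law w ∅ (τ := (.movingDown, 0)) (L := L)
      (fun h => by cases hmem _ h) (fun c h => by cases h) q
    simpa [hup, localExits, ← hL] using this
  rw [lintegral_congr h1, lintegral_finsetSum _ fun _ _ => Measurable.of_discrete]
  simp only [lintegral_const_mul _ Measurable.of_discrete, e1]
  rw [← Finset.sum_mul, hsum, one_mul]

end ExploreLaw

/-! ### Independence of subtrees and the recursion for the exit laws -/

theorem measurePreserving_prod_prod_comm {α β γ δ : Type*} [MeasurableSpace α] [MeasurableSpace β]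
    [MeasurableSpace γ] [MeasurableSpace δ] (μ : Measure α) (ν : Measure β) (ρ : Measure γ)
    (τ : Measure δ) [SFinite μ] [SFinite ν] [SFinite ρ] [SFinite τ] :
    MeasurePreserving (fun z : (α × β) × (γ × δ) => ((z.1.1, z.2.1), (z.1.2, z.2.2)))
      ((μ.prod ν).prod (ρ.prod τ)) ((μ.prod ρ).prod (ν.prod τ)) := by
  have h1 : MeasurePreserving MeasurableEquiv.prodAssoc ((μ.prod ν).prod (ρ.prod τ))
      (μ.prod (ν.prod (ρ.prod τ))) := ⟨MeasurableEquiv.measurable _, Measure.prodAssoc_prod⟩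
  have h2 : MeasurePreserving MeasurableEquiv.prodAssoc ((ν.prod ρ).prod τ)
      (ν.prod (ρ.prod τ)) := ⟨MeasurableEquiv.measurable _, Measure.prodAssoc_prod⟩
  have h3 : MeasurePreserving MeasurableEquiv.prodAssoc ((ρ.prod ν).prod τ)
      (ρ.prod (ν.prod τ)) := ⟨MeasurableEquiv.measurable _, Measure.prodAssoc_prod⟩
  have h4 : MeasurePreserving MeasurableEquiv.prodAssoc ((μ.prod ρ).prod (ν.prod τ))
      (μ.prod (ρ.prod (ν.prod τ))) := ⟨MeasurableEquiv.measurable _, Measure.prodAssoc_prod⟩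
  have h5 : MeasurePreserving (Prod.map Prod.swap id) ((ν.prod ρ).prod τ) ((ρ.prod ν).prod τ) :=
    Measure.measurePreserving_swap.prod (MeasurePreserving.id τ)
  exact (h4.symm _).comp
    (((MeasurePreserving.id μ).prod (h3.comp (h5.comp (h2.symm _)))).comp h1)

section TreeLaw

variable {d : ℕ} (ν : PMF ℕ) (law : Mode d → PMF (Move d))

/-- The joint law of the numbers of frogs and of the stacks of instructions. -/
noncomputable abbrev stackLaw : Measure ((Vertex d → ℕ) × Stack d) :=
  (Measure.infinitePi fun _ : Vertex d => ν.toMeasure).prod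
    (Measure.infinitePi fun i : Vertex d × Mode d × ℕ => (law i.2.1).toMeasure)

/-- The numbers of frogs and the instructions at the vertices in `s` are the same. -/
def AgreeOn (s : Set (Vertex d)) (ω ω' : (Vertex d → ℕ) × Stack d) : Prop :=
  ∀ v ∈ s, ω.1 v = ω'.1 v ∧ ∀ x, ω.2 (v, x) = ω'.2 (v, x)

/-- Resampling everything outside `s` preserves the law; all independence between regions of the
tree is derived from this. -/
theorem exists_measurePreserving_mix (s : Set (Vertex d)) :
    ∃ mix : ((Vertex d → ℕ) × Stack d) × ((Vertex d → ℕ) × Stack d) → (Vertex d → ℕ) × Stack d,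
      MeasurePreserving mix ((stackLaw ν law).prod (stackLaw ν law)) (stackLaw ν law) ∧
      ∀ z, AgreeOn s z.1 (mix z) ∧ AgreeOn sᶜ z.2 (mix z) := by
  classical
  refine ⟨_, ((measurePreserving_piecewise (fun _ : Vertex d => ν.toMeasure) s).prod
    (measurePreserving_piecewise (fun i : Vertex d × Mode d × ℕ => (law i.2.1).toMeasure)
      {i | i.1 ∈ s})).comp (measurePreserving_prod_prod_comm _ _ _ _), fun z => ⟨?_, ?_⟩⟩
  · intro v hv
    simp [hv]
  · intro v hv
    have hv' : v ∉ s := hv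
    simp [hv']

/-- Events that depend on disjoint sets of vertices are independent. -/
theorem stackLaw_inter (s : Set (Vertex d)) {C G : Set ((Vertex d → ℕ) × Stack d)}
    (hC : MeasurableSet C) (hG : MeasurableSet G)
    (hCs : ∀ ω ω', AgreeOn s ω ω' → (ω ∈ C ↔ ω' ∈ C))
    (hGs : ∀ ω ω', AgreeOn sᶜ ω ω' → (ω ∈ G ↔ ω' ∈ G)) :
    stackLaw ν law (C ∩ G) = stackLaw ν law C * stackLaw ν law G := by
  obtain ⟨mix, hmix, hz⟩ := exists_measurePreserving_mix ν law s
  rw [← hmix.measure_preimage (hC.inter hG).nullMeasurableSet, ← Measure.prod_prod]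
  congr 1
  ext z
  exact and_congr (hCs _ _ (hz z).1).symm (hGs _ _ (hz z).2).symm

/-- Vertices are lists with the latest step in front, so the subtree at `v` consists of the lists
with suffix `v`. -/
theorem subtreeExits_congr {ω ω' : (Vertex d → ℕ) × Stack d} (n : ℕ) : ∀ v : Vertex d,
    AgreeOn {u | v <:+ u} ω ω' → subtreeExits ω.1 ω.2 n v = subtreeExits ω'.1 ω'.2 n v := by
  induction n with
  | zero => exact fun _ _ => rfl
  | succ n ih =>
    intro v h
    have h1 : ω.1 v = ω'.1 v := (h v List.suffix_rfl).1
    have h2 : ω.2.instr v = ω'.2.instr v := funext fun x => (h v List.suffix_rfl).2 x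
    have h3 : (fun c => subtreeExits ω.1 ω.2 n (c :: v)) =
        fun c => subtreeExits ω'.1 ω'.2 n (c :: v) :=
      funext fun c => ih (c :: v) fun u hu => h u ((List.suffix_cons c v).trans hu)
    rw [subtreeExits, subtreeExits, h1, h2, h3]

theorem measurable_localExits : Measurable fun x : (ℕ × (Mode d × ℕ → Move d)) × (Fin d → ℕ) =>
    localExits x.1.2 x.1.1 x.2 := by
  refine measurable_from_prod_countable_left fun w => ?_
  refine measurable_from_prod_countable_right fun n => ?_
  simpa only [localExits] using measurable_explore w ∅ _

theorem measurable_subtreeExits (n : ℕ) (v : Vertex d) :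
    Measurable fun ω : (Vertex d → ℕ) × Stack d => subtreeExits ω.1 ω.2 n v := by
  induction n generalizing v with
  | zero => exact measurable_const
  | succ n ih =>
    have h1 : Measurable fun ω : (Vertex d → ℕ) × Stack d => (ω.1 v, ω.2.instr v) :=
      ((measurable_pi_apply v).comp measurable_fst).prodMk
        (measurable_pi_lambda _ fun x => (measurable_pi_apply (v, x.1, x.2)).comp measurable_snd)
    exact measurable_localExits.comp (h1.prodMk (measurable_pi_lambda _ fun c => ih (c :: v)))

/-- The law of `subtreeExits`. -/
noncomputable def exitLaw : ℕ → Measure ℕ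
  | 0 => Measure.dirac 0
  | n + 1 => ((ν.toMeasure.prod (instrLaw law)).prod
      (Measure.infinitePi fun _ : Fin d => exitLaw n)).map fun x => localExits x.1.2 x.1.1 x.2

instance isProbabilityMeasure_exitLaw (n : ℕ) : IsProbabilityMeasure (exitLaw ν law n) := by
  induction n with
  | zero => exact inferInstanceAs (IsProbabilityMeasure (Measure.dirac 0))
  | succ n ih => exact Measure.isProbabilityMeasure_map measurable_localExits.aemeasurable

theorem map_local (v : Vertex d) :
    (stackLaw ν law).map (fun ω => (ω.1 v, ω.2.instr v)) = ν.toMeasure.prod (instrLaw law) := by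
  have hm : Measurable fun η : Stack d => η.instr v :=
    measurable_pi_lambda _ fun x => measurable_pi_apply (v, x.1, x.2)
  have h1 : (Measure.infinitePi fun i : Vertex d × Mode d × ℕ => (law i.2.1).toMeasure).map
      (fun η : Stack d => η.instr v) = instrLaw law := by
    refine Measure.eq_infinitePi (μ := fun x : Mode d × ℕ => (law x.1).toMeasure) fun t B hB => ?_
    rw [Measure.map_apply hm (MeasurableSet.pi t.countable_toSet fun i _ => hB i)]
    have : (fun η : Stack d => η.instr v) ⁻¹' (t : Set (Mode d × ℕ)).pi B =
        ((t.map ⟨fun x => (v, x), fun x y h => (Prod.mk.inj h).2⟩ :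
          Finset (Vertex d × Mode d × ℕ)) : Set (Vertex d × Mode d × ℕ)).pi fun i => B i.2 := by
      ext η
      simp only [Set.mem_preimage, Set.mem_pi, Finset.coe_map, Set.forall_mem_image]
      rfl
    rw [this, Measure.infinitePi_pi _ fun i _ => hB _, Finset.prod_map]
    rfl
  rw [← h1, ← Measure.infinitePi_map_eval (fun _ : Vertex d => ν.toMeasure) v,
    Measure.map_prod_map _ _ (measurable_pi_apply v) hm]
  rfl

theorem map_children (n : ℕ) (v : Vertex d)
    (h : ∀ u : Vertex d, (stackLaw ν law).map (fun ω => subtreeExits ω.1 ω.2 n u) =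
      exitLaw ν law n) :
    (stackLaw ν law).map (fun ω c => subtreeExits ω.1 ω.2 n (c :: v)) =
      Measure.infinitePi fun _ : Fin d => exitLaw ν law n := by
  classical
  refine Measure.eq_infinitePi (μ := fun _ : Fin d => exitLaw ν law n) fun t B _ => ?_
  have hm : Measurable fun (ω : (Vertex d → ℕ) × Stack d) (c : Fin d) =>
      subtreeExits ω.1 ω.2 n (c :: v) :=
    measurable_pi_lambda _ fun c => measurable_subtreeExits n (c :: v)
  have hE : ∀ c, MeasurableSet {ω : (Vertex d → ℕ) × Stack d |
      subtreeExits ω.1 ω.2 n (c :: v) ∈ B c} :=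
    fun c => measurable_subtreeExits n (c :: v) (MeasurableSet.of_discrete (s := B c))
  rw [Measure.map_apply hm MeasurableSet.of_discrete]
  have hpre : ∀ t : Finset (Fin d), (fun (ω : (Vertex d → ℕ) × Stack d) (c : Fin d) =>
      subtreeExits ω.1 ω.2 n (c :: v)) ⁻¹' (t : Set (Fin d)).pi B =
        ⋂ c ∈ t, {ω | subtreeExits ω.1 ω.2 n (c :: v) ∈ B c} := by
    intro t
    ext ω
    simp [Set.mem_pi]
  rw [hpre]
  induction t using Finset.induction_on with
  | empty => simp
  | insert c t hc ih =>
    rw [Finset.set_biInter_insert, Finset.prod_insert hc, ← ih,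
      stackLaw_inter ν law {u | c :: v <:+ u} (hE c) (Finset.measurableSet_biInter _ fun c _ => hE c)]
    · congr 1
      rw [← h (c :: v), Measure.map_apply (measurable_subtreeExits n _) MeasurableSet.of_discrete]
      rfl
    · intro ω ω' hω
      simp only [Set.mem_ofPred_eq, subtreeExits_congr n _ hω]
    · intro ω ω' hω
      simp only [Set.mem_iInter, Set.mem_ofPred_eq]
      refine forall₂_congr fun c' hc' => ?_
      rw [subtreeExits_congr n (c' :: v) fun u hu => hω u ?_]
      intro hu'
      have hu : c' :: v <:+ u := hu
      have hu' : c :: v <:+ u := hu'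
      -- Suffixes of one list with equal length coincide, so the subtrees of distinct siblings are
      -- disjoint.
      have := List.suffix_of_suffix_length_le hu hu' (by simp)
      have := List.IsSuffix.eq_of_length this (by simp)
      rw [List.cons.injEq] at this
      exact hc (this.1 ▸ hc')

/-- The data at `v` are independent of the subtrees of its children, since `v` lies in none of them;
the children are handled by `map_children`. -/
theorem map_subtreeExits (n : ℕ) : ∀ v : Vertex d,
    (stackLaw ν law).map (fun ω => subtreeExits ω.1 ω.2 n v) = exitLaw ν law n := by
  induction n with
  | zero =>
    intro v
    simp only [subtreeExits, exitLaw, Measure.map_const, measure_univ, one_smul]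
  | succ n ih =>
    intro v
    have h1 : Measurable fun ω : (Vertex d → ℕ) × Stack d => (ω.1 v, ω.2.instr v) :=
      ((measurable_pi_apply v).comp measurable_fst).prodMk
        (measurable_pi_lambda _ fun x => (measurable_pi_apply (v, x.1, x.2)).comp measurable_snd)
    have h2 : Measurable fun (ω : (Vertex d → ℕ) × Stack d) (c : Fin d) =>
        subtreeExits ω.1 ω.2 n (c :: v) :=
      measurable_pi_lambda _ fun c => measurable_subtreeExits n (c :: v)
    obtain ⟨mix, hmix, hz⟩ := exists_measurePreserving_mix ν law {v}
    have h3 : (fun z => ((fun ω : (Vertex d → ℕ) × Stack d => ((ω.1 v, ω.2.instr v),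
        fun c => subtreeExits ω.1 ω.2 n (c :: v))) ∘ mix) z) =
        Prod.map (fun ω : (Vertex d → ℕ) × Stack d => (ω.1 v, ω.2.instr v))
          (fun ω c => subtreeExits ω.1 ω.2 n (c :: v)) := by
      funext z
      have hv := (hz z).1 v rfl
      refine Prod.ext (Prod.ext hv.1.symm (funext fun x => (hv.2 x).symm)) (funext fun c => ?_)
      refine (subtreeExits_congr n (c :: v) fun u hu => (hz z).2 u ?_).symm
      rintro rfl
      have hu : c :: u <:+ u := hu
      have := hu.length_le
      simp at this
    have h4 : (stackLaw ν law).map (fun ω => ((ω.1 v, ω.2.instr v),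
        fun c => subtreeExits ω.1 ω.2 n (c :: v))) =
        (ν.toMeasure.prod (instrLaw law)).prod
          (Measure.infinitePi fun _ : Fin d => exitLaw ν law n) := by
      rw [← map_local ν law v, ← map_children ν law n v ih, Measure.map_prod_map _ _ h1 h2, ← h3]
      conv_lhs => rw [← hmix.map_eq]
      rw [Measure.map_map (h1.prodMk h2) hmix.measurable]
    rw [exitLaw, ← h4, Measure.map_map measurable_localExits (h1.prodMk h2)]
    rfl

variable {law}

theorem exitLaw_succ_tail [NeZero d] {up σ : Bool → ENNReal} (hlaw : HasJumpProbs law up σ)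
    (n q : ℕ) : exitLaw ν law (n + 1) {m | q ≤ m} =
      ∫⁻ k, chainNext up σ (exitLaw ν law n) d (List.replicate k true) q ∂ν.toMeasure := by
  have hE : MeasurableSet {x : (ℕ × (Mode d × ℕ → Move d)) × (Fin d → ℕ) |
      q ≤ localExits x.1.2 x.1.1 x.2} := measurableSet_le measurable_const measurable_localExits
  rw [exitLaw, Measure.map_apply measurable_localExits MeasurableSet.of_discrete]
  have : (fun x : (ℕ × (Mode d × ℕ → Move d)) × (Fin d → ℕ) => localExits x.1.2 x.1.1 x.2) ⁻¹'
      {m | q ≤ m} = {x | q ≤ localExits x.1.2 x.1.1 x.2} := rfl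
  rw [this, Measure.prod_apply_symm hE]
  have h1 : ∀ w : Fin d → ℕ, (ν.toMeasure.prod (instrLaw law))
      ((fun x => (x, w)) ⁻¹' {x | q ≤ localExits x.1.2 x.1.1 x.2}) =
        ∫⁻ k, instrLaw law {ζ | q ≤ localExits ζ k w} ∂ν.toMeasure := by
    intro w
    rw [Measure.prod_apply (hE.preimage measurable_prodMk_right)]
    rfl
  rw [lintegral_congr h1, lintegral_lintegral_swap Measurable.of_discrete.aemeasurable]
  exact lintegral_congr fun k => lintegral_localExits hlaw _ k q

/-- The law of the number of root visits in terms of `exitLaw`. -/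
theorem stackLaw_exits [NeZero d] {up σ : Bool → ENNReal} (hlaw : HasJumpProbs law up σ) (m : ℕ) :
    MeasurableSet {ω : (Vertex d → ℕ) × Stack d | ∃ j n,
      ω.2 ([], .movingDown, 0) = .toChild j ∧ m ≤ subtreeExits ω.1 ω.2 n [j]} ∧
    stackLaw ν law {ω | ∃ j n, ω.2 ([], .movingDown, 0) = .toChild j ∧
      m ≤ subtreeExits ω.1 ω.2 n [j]} = ⨆ n, exitLaw ν law n {k | m ≤ k} := by
  classical
  let A : Fin d → Set ((Vertex d → ℕ) × Stack d) :=
    fun j => {ω | ω.2 ([], .movingDown, 0) = .toChild j}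
  let D : Fin d → ℕ → Set ((Vertex d → ℕ) × Stack d) :=
    fun j n => {ω | m ≤ subtreeExits ω.1 ω.2 n [j]}
  have hA : ∀ j, MeasurableSet (A j) := fun j =>
    (measurableSet_singleton (Move.toChild j)).preimage
      ((measurable_pi_apply (([], .movingDown, 0) : Vertex d × Mode d × ℕ)).comp measurable_snd)
  have hD : ∀ j n, MeasurableSet (D j n) := fun j n =>
    measurableSet_le measurable_const (measurable_subtreeExits n [j])
  have hset : {ω : (Vertex d → ℕ) × Stack d | ∃ j n,
      ω.2 ([], .movingDown, 0) = .toChild j ∧ m ≤ subtreeExits ω.1 ω.2 n [j]} =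
      ⋃ j ∈ (Finset.univ : Finset (Fin d)), A j ∩ ⋃ n, D j n := by
    ext ω
    simp [A, D]
  have hU : ∀ j, MeasurableSet (⋃ n, D j n) := fun j => MeasurableSet.iUnion (hD j)
  rw [hset]
  refine ⟨Finset.measurableSet_biUnion _ fun j _ => (hA j).inter (hU j), ?_⟩
  rw [measure_biUnion_finset _ fun j _ => (hA j).inter (hU j)]
  · have h1 : ∀ j, stackLaw ν law (A j) = (d : ENNReal)⁻¹ := by
      intro j
      have : A j = Set.univ ×ˢ ((fun η : Stack d => η ([], .movingDown, 0)) ⁻¹' {.toChild j}) := by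
        ext ω
        simp [A]
      rw [this, Measure.prod_prod, measure_univ, one_mul,
        ← Measure.map_apply (measurable_pi_apply _) MeasurableSet.of_discrete,
        Measure.infinitePi_map_eval, PMF.toMeasure_apply_singleton _ _ MeasurableSet.of_discrete,
        hlaw.down_child]
    have h2 : ∀ j, stackLaw ν law (⋃ n, D j n) = ⨆ n, exitLaw ν law n {k | m ≤ k} := by
      intro j
      rw [Monotone.measure_iUnion]
      · refine iSup_congr fun n => ?_
        rw [← map_subtreeExits ν law n [j],
          Measure.map_apply (measurable_subtreeExits n [j]) MeasurableSet.of_discrete]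
        rfl
      · exact monotone_nat_of_le_succ fun n ω hω =>
          le_trans (show m ≤ _ from hω) (subtreeExits_le_succ n [j])
    have h3 : ∀ j, stackLaw ν law (A j ∩ ⋃ n, D j n) =
        (d : ENNReal)⁻¹ * ⨆ n, exitLaw ν law n {k | m ≤ k} := by
      intro j
      rw [stackLaw_inter ν law {[]} (hA j) (hU j), h1, h2]
      · intro ω ω' h
        simp only [A, Set.mem_ofPred_eq, (h [] rfl).2]
      · intro ω ω' h
        simp only [D, Set.mem_iUnion, Set.mem_ofPred_eq]
        refine exists_congr fun n => ?_
        rw [subtreeExits_congr n [j] fun u hu => h u ?_]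
        rintro rfl
        have hu : [j] <:+ [] := hu
        simpa using hu.length_le
    simp only [h3, Finset.sum_const, Finset.card_univ, Fintype.card_fin, nsmul_eq_mul]
    rw [← mul_assoc, ENNReal.mul_inv_cancel (by exact_mod_cast NeZero.ne d)
      (ENNReal.natCast_ne_top d), one_mul]
  · intro i _ j _ hij
    refine Set.disjoint_left.2 fun ω h h' => hij ?_
    have := (show _ = _ from h.1).symm.trans (show _ = _ from h'.1)
    simpa using this

end TreeLaw

/-! ### Comparison of the parameters for `d` and `d + 1` -/

/-- The probability that a frog that has just been woken (`true`), or that has jumped towards the root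
(`false`), jumps to the parent. -/
noncomputable def upProb (d : ℕ) (p : ℝ) (a : Bool) : ENNReal :=
  ENNReal.ofReal (if a then pStar d p else pHat p)

/-- The probability that such a frog jumps to a given admissible child. -/
noncomputable def childProb (d : ℕ) (p : ℝ) (a : Bool) : ENNReal :=
  ENNReal.ofReal (if a then (1 - pStar d p) / d else (1 - pHat p) / (d - 1))

theorem hasJumpProbs_jumpLaw {d : ℕ} (hd : 2 ≤ d) {p : ℝ} (hp : p ∈ Set.Ioo (0 : ℝ) (1 / 2)) :
    HasJumpProbs (jumpLaw hd hp) (upProb d p) (childProb d p) where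
  woken_up := rfl
  woken_child _ := rfl
  returned_up _ := rfl
  returned_child c c' h := by
    simp [jumpLaw, PMF.ofFintype_apply, jumpProb, h, childProb]
  down_child c := by
    have : (0 : ℝ) < d := by exact_mod_cast (by omega : 0 < d)
    simp only [jumpLaw, PMF.ofFintype_apply, jumpProb]
    rw [one_div, ENNReal.ofReal_inv_of_pos this, ENNReal.ofReal_natCast]

theorem den_pos {d : ℕ} (hd : 2 ≤ d) {p : ℝ} (hp : p ∈ Set.Ioo (0 : ℝ) (1 / 2)) :
    0 < (d : ℝ) - (d + 1) * p := by
  have hd' : (2 : ℝ) ≤ d := by exact_mod_cast hd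
  nlinarith [hp.1, hp.2]

/-- The numerator of `1 - pStar d p` is `d * (1 - 2 * p)`, so the factor `d` cancels. -/
theorem one_sub_pStar {d : ℕ} (hd : 2 ≤ d) {p : ℝ} (hp : p ∈ Set.Ioo (0 : ℝ) (1 / 2)) :
    (1 - pStar d p) / d = (1 - 2 * p) / (d - (d + 1) * p) := by
  have h1 := den_pos hd hp
  have hd' : (0 : ℝ) < d := by exact_mod_cast (by omega : 0 < d)
  rw [pStar, div_eq_div_iff hd'.ne' h1.ne', sub_mul, div_mul_cancel₀ _ h1.ne']
  ring

theorem upProb_mono {d : ℕ} (hd : 2 ≤ d) {p : ℝ} (hp : p ∈ Set.Ioo (0 : ℝ) (1 / 2))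
    (a : Bool) : upProb d p a ≤ upProb (d + 1) p a := by
  refine ENNReal.ofReal_le_ofReal ?_
  cases a with
  | false => exact le_rfl
  | true =>
    have h1 := den_pos hd hp
    have h2 := den_pos (Nat.le_succ_of_le hd) hp
    obtain ⟨h3, h4⟩ := hp
    simp only [if_true, pStar]
    push_cast at h2 ⊢
    rw [div_le_div_iff₀ h1 h2]
    -- After cross-multiplication the two sides differ by exactly `p * (1 - 2 * p)`.
    nlinarith [mul_pos h3 (by linarith : 0 < 1 - 2 * p)]

theorem childProb_mono {d : ℕ} (hd : 2 ≤ d) {p : ℝ} (hp : p ∈ Set.Ioo (0 : ℝ) (1 / 2))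
    (a : Bool) (g : ℕ) (hg : g ≤ d - 1) :
    (g : ENNReal) * childProb d p a ≤ (g + 1 : ℕ) * childProb (d + 1) p a := by
  rw [childProb, childProb, ← ENNReal.ofReal_natCast, ← ENNReal.ofReal_natCast,
    ← ENNReal.ofReal_mul (Nat.cast_nonneg _), ← ENNReal.ofReal_mul (Nat.cast_nonneg _)]
  refine ENNReal.ofReal_le_ofReal ?_
  have hd' : (2 : ℝ) ≤ d := by exact_mod_cast hd
  have hg' : (g : ℝ) ≤ d - 1 := by
    rw [← Nat.cast_one, ← Nat.cast_sub (by omega)]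
    exact_mod_cast hg
  have hg0 : (0 : ℝ) ≤ g := Nat.cast_nonneg _
  cases a with
  | true =>
    simp only [if_true]
    rw [one_sub_pStar hd hp, one_sub_pStar (Nat.le_succ_of_le hd) hp]
    have h1 := den_pos hd hp
    have h2 := den_pos (Nat.le_succ_of_le hd) hp
    obtain ⟨h3, h4⟩ := hp
    push_cast at h2 ⊢
    rw [← mul_div_assoc, ← mul_div_assoc, div_le_div_iff₀ h1 h2]
    have h5 : 0 ≤ 1 - 2 * p := by linarith
    -- The right side minus the left is `d - (d + 1) * p - g * (1 - p)`, which is at least `1 - 2 *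
    -- p` when `g ≤ d - 1`.
    have h6 : (g : ℝ) * (d + 1 - (d + 1 + 1) * p) ≤ (g + 1) * (d - (d + 1) * p) := by
      nlinarith [mul_le_mul_of_nonneg_right hg' (by linarith : 0 ≤ 1 - p)]
    nlinarith [mul_le_mul_of_nonneg_left h6 h5]
  | false =>
    simp only [Bool.false_eq_true, if_false]
    have h0 : 0 ≤ 1 - pHat p := by
      rw [pHat, sub_nonneg, div_le_one (by linarith [hp.2])]
      linarith [hp.2]
    push_cast
    rw [← mul_div_assoc, ← mul_div_assoc, div_le_div_iff₀ (by linarith) (by linarith)]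
    have h6 : (g : ℝ) * (d + 1 - 1) ≤ (g + 1) * (d - 1) := by linarith
    nlinarith [mul_le_mul_of_nonneg_left h6 h0]

/-- The factor is `d - 1` because one child is already open when the chain starts. For returned
frogs the sum is exactly 1. -/
theorem upProb_add_childProb_le {d : ℕ} (hd : 2 ≤ d) {p : ℝ} (hp : p ∈ Set.Ioo (0 : ℝ) (1 / 2))
    (a : Bool) : upProb d p a + (d - 1 : ℕ) * childProb d p a ≤ 1 := by
  have hd' : (2 : ℝ) ≤ d := by exact_mod_cast hd
  have h0 := jumpProb_nonneg hd hp .justWoken .toParent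
  have h1 := jumpProb_nonneg hd hp .justWoken (.toChild ⟨0, by omega⟩)
  have h2 := jumpProb_nonneg hd hp (.cameUp ⟨0, by omega⟩) .toParent
  have h3 := jumpProb_nonneg hd hp (.cameUp ⟨0, by omega⟩) (.toChild ⟨1, by omega⟩)
  simp only [jumpProb, Fin.mk.injEq, one_ne_zero, if_false] at h0 h1 h2 h3
  rw [upProb, childProb, ← ENNReal.ofReal_natCast, ← ENNReal.ofReal_mul (Nat.cast_nonneg _),
    ← ENNReal.ofReal_add, ← ENNReal.ofReal_one]
  · refine ENNReal.ofReal_le_ofReal ?_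
    rw [Nat.cast_sub (by omega), Nat.cast_one]
    cases a with
    | true =>
      simp only [if_true]
      have : (d : ℝ) * ((1 - pStar d p) / d) = 1 - pStar d p := by field_simp
      nlinarith
    | false =>
      simp only [Bool.false_eq_true, if_false]
      have : ((d : ℝ) - 1) * ((1 - pHat p) / (d - 1)) = 1 - pHat p :=
        mul_div_cancel₀ _ (by linarith)
      linarith
  · split_ifs
    · exact h0
    · exact h2
  · refine mul_nonneg (Nat.cast_nonneg _) ?_
    split_ifs
    · exact h1
    · exact h3

/-- With `d = G + 1`, one child is opened in each tree, leaving `G` and `G + 1`. The induction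
hypothesis is used twice: inside `chain_le_chain`, and for the frogs that come back from this first
child. -/
theorem exitLaw_tail_le {d : ℕ} (hd : 2 ≤ d) {p : ℝ} (hp : p ∈ Set.Ioo (0 : ℝ) (1 / 2))
    (ν : PMF ℕ) (n m : ℕ) :
    exitLaw ν (jumpLaw hd hp) n {k | m ≤ k} ≤
      exitLaw ν (jumpLaw (Nat.le_succ_of_le hd) hp) n {k | m ≤ k} := by
  have : NeZero d := ⟨by omega⟩
  induction n generalizing m with
  | zero => exact le_rfl
  | succ n ih =>
    rw [exitLaw_succ_tail ν (hasJumpProbs_jumpLaw hd hp),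
      exitLaw_succ_tail ν (hasJumpProbs_jumpLaw (Nat.le_succ_of_le hd) hp)]
    obtain ⟨G, rfl⟩ : ∃ G, d = G + 1 := ⟨d - 1, by omega⟩
    have hG' := upProb_add_childProb_le (Nat.le_succ_of_le hd) hp
    refine lintegral_mono fun k => ?_
    refine (lintegral_mono fun j => ?_).trans (lintegral_le_of_tail_le ih ?_)
    · exact chain_le_chain (G := G) hG' (upProb_mono hd hp)
        (fun a g hg => childProb_mono hd hp a g hg) ih G le_rfl _ _
    · exact chain_replicate_mono (G := G + 1) hG' le_rfl _ _

/-- The right side is free of `rank`, so different priority orders in the two models do no harm. -/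
theorem measure_le_rootVisits_eq {d : ℕ} (hd : 2 ≤ d) {p : ℝ} (hp : p ∈ Set.Ioo (0 : ℝ) (1 / 2))
    (ν : PMF ℕ) {rank : Frog d → ℕ} (hrank : Function.Injective rank)
    {m : ℕ} (hm : m ≠ 0) :
    sampleLaw hd hp ν {ω | m ≤ rootVisits rank ω} =
      ⨆ n, exitLaw ν (jumpLaw hd hp) n {k | m ≤ k} := by
  have : NeZero d := ⟨by omega⟩
  obtain ⟨h1, h2⟩ := stackLaw_exits ν (hasJumpProbs_jumpLaw hd hp) m
  have hV : MeasurableSet {ω | m ≤ rootVisits rank ω} :=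
    measurable_rootVisits (MeasurableSet.of_discrete (s := {z : ℕ∞ | (m : ℕ∞) ≤ z}))
  rw [← h2, sampleLaw, Measure.prod_apply hV, Measure.prod_apply h1]
  refine lintegral_congr fun N => ?_
  refine (measure_le_rootVisits hrank (jumpLaw hd hp) N m).trans ?_
  simp only [exists_le_exits_iff hm]
  rfl

instance isProbabilityMeasure_sampleLaw {d : ℕ} (hd : 2 ≤ d) {p : ℝ}
    (hp : p ∈ Set.Ioo (0 : ℝ) (1 / 2)) (ν : PMF ℕ) : IsProbabilityMeasure (sampleLaw hd hp ν) := by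
  unfold sampleLaw
  infer_instance

end SelfSimilarFrog

theorem theorem2 (d : ℕ) (hd : 2 ≤ d) (p : ℝ) (hp : p ∈ Set.Ioo (0 : ℝ) (1 / 2)) (ν : PMF ℕ)
    (rank : SelfSimilarFrog.Frog d → ℕ) (hrank : Function.Injective rank)
    (rank' : SelfSimilarFrog.Frog (d + 1) → ℕ) (hrank' : Function.Injective rank') :
    SelfSimilarFrog.StochLE
      (SelfSimilarFrog.sampleLaw hd hp ν)
      (SelfSimilarFrog.sampleLaw (Nat.le_succ_of_le hd) hp ν)
      (SelfSimilarFrog.rootVisits rank) (SelfSimilarFrog.rootVisits rank') := by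
  refine SelfSimilarFrog.stochLE_of_tail_le SelfSimilarFrog.measurable_rootVisits
    SelfSimilarFrog.measurable_rootVisits fun m => ?_
  rcases eq_or_ne m 0 with rfl | hm
  · simp
  · rw [SelfSimilarFrog.measure_le_rootVisits_eq hd hp ν hrank hm,
      SelfSimilarFrog.measure_le_rootVisits_eq (Nat.le_succ_of_le hd) hp ν hrank' hm]
    exact iSup_mono fun n => SelfSimilarFrog.exitLaw_tail_le hd hp ν n m
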